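/- Let $p$ be a prime, let $P=\mathbb F_p[x,y]$, and let $GL_2(\mathbb F_p)$ act on $P$ by $\mathbb F_p$-algebra automorphisms extending its linear action on $\mathbb F_p^2$ with standard basis $x,y$, i.e. $\begin{pmatrix}a&b\\c&d\end{pmatrix}$ sends $x\mapsto ax+cy$ and $y\mapsto bx+dy$. For a divisor $r$ of $p-1$ let $$L^r=\{A\in GL_2(\mathbb F_p)\mid \det(A^r)=1\},$$ let $J_1(L^r)\subset P$ be the ideal generated by the homogeneous $L^r$-invariant polynomials of positive degree, and let $P_{L^r}=P/J_1(L^r)$ be the coinvariant algebra with its induced grading and $L^r$-action. Let $A$ be the sum of the homogeneous components of positive degree of $P_{L^r}$ and let $A^{L^r}$ be the $\mathbb F_p$-vector space of $L^r$-invariant elements of $A$. 1. If $r>1$, then $A^{L^r}=0$. 2. If $r=1$, then $A^{L^r}$ is spanned as an $\mathbb F_p$-vector space by the classes of - $\mu=x^{p-1}y^{p^2-p}$, which is a fundamental class of $P_{L^1}$ (a nonzero element spanning its homogeneous component of highest degree), and - $\gamma_i=x^{i(p-1)}-x^{p-1}y^{(i-1)(p-1)}+y^{i(p-1)}$ for $i=2,\dots,p-1$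 (there are none when $p=2$). -/

import Mathlib

namespace CoinvGL2

open MvPolynomial

variable (p : ℕ) [Fact p.Prime]

/-- The polynomial ring `P = 𝔽_p[x, y]`. -/
abbrev P : Type := MvPolynomial (Fin 2) (ZMod p)

/-- The group `GL₂(𝔽_p)`. -/
abbrev GL2 : Type := Matrix.GeneralLinearGroup (Fin 2) (ZMod p)

/-- The variable `x`. -/
noncomputable abbrev x : P p := X 0

/-- The variable `y`. -/
noncomputable abbrev y : P p := X 1

variable {p}

/-- Linear substitution by a matrix: the variables are the standard basis (of column vectors),
so the `j`-th variable goes to the linear form given by the `j`-th column. -/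
noncomputable def subst (A : Matrix (Fin 2) (Fin 2) (ZMod p)) : P p →ₐ[ZMod p] P p :=
  aeval fun j => ∑ i, C (A i j) * X i

theorem subst_X (A : Matrix (Fin 2) (Fin 2) (ZMod p)) (j : Fin 2) :
    subst A (X j) = ∑ i, C (A i j) * X i := by
  simp [subst]

theorem subst_one : subst (1 : Matrix (Fin 2) (Fin 2) (ZMod p)) = AlgHom.id _ _ := by
  ext j : 1
  fin_cases j <;> simp [subst_X]

theorem subst_mul (A B : Matrix (Fin 2) (Fin 2) (ZMod p)) :
    subst (A * B) = (subst A).comp (subst B) := by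
  have hC : ∀ (D : Matrix (Fin 2) (Fin 2) (ZMod p)) (a : ZMod p), subst D (C a) = C a :=
    fun D a => (subst D).commutes a
  ext j : 1
  simp only [AlgHom.comp_apply, subst_X, map_mul, hC, Matrix.mul_apply, Fin.sum_univ_two,
    map_add]
  ring

/-- The action of `GL₂(𝔽_p)` on `P` by algebra endomorphisms (a left action). -/
noncomputable def act : GL2 p →* (P p →ₐ[ZMod p] P p) where
  toFun g := subst (g : Matrix (Fin 2) (Fin 2) (ZMod p))
  map_one' := subst_one
  map_mul' _ _ := subst_mul _ _

/-- `f` lies in the ring of invariants `P^G`. -/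
def IsInvariant (G : Subgroup (GL2 p)) (f : P p) : Prop := ∀ g ∈ G, act g f = f

/-- The ideal `J₁(G)` generated by the (homogeneous) invariants of positive degree. -/
noncomputable def J1 (G : Subgroup (GL2 p)) : Ideal (P p) :=
  Ideal.span {f | IsInvariant G f ∧ ∃ n : ℕ, 0 < n ∧ f.IsHomogeneous n}

theorem J1_le_comap (G : Subgroup (GL2 p)) (g : G) : J1 G ≤ (J1 G).comap (act (g : GL2 p)) := by
  refine Ideal.span_le.2 fun f hf => ?_
  change act (g : GL2 p) f ∈ J1 G
  rw [hf.1 g g.2]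
  exact Ideal.subset_span hf

/-- The coinvariant algebra `P_G = P / J₁(G)`. -/
abbrev Coinv (G : Subgroup (GL2 p)) : Type := P p ⧸ J1 G

/-- The projection `P → P_G`. -/
noncomputable abbrev proj (G : Subgroup (GL2 p)) : P p →ₐ[ZMod p] Coinv G :=
  Ideal.Quotient.mkₐ (ZMod p) (J1 G)

/-- The endomorphism of `P_G` induced by the action of `g ∈ G` on `P`. -/
noncomputable def coinvAct (G : Subgroup (GL2 p)) (g : G) : Coinv G →ₐ[ZMod p] Coinv G :=
  Ideal.quotientMapₐ (J1 G) (act (g : GL2 p)) (J1_le_comap G g)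

/-- The action of `G` on the coinvariant algebra `P_G` induced by the action on `P`. -/
noncomputable def coinvRep (G : Subgroup (GL2 p)) : Representation (ZMod p) G (Coinv G) where
  toFun g := (coinvAct G g).toLinearMap
  map_one' := by
    refine LinearMap.ext fun a => ?_
    obtain ⟨f, rfl⟩ := Ideal.Quotient.mk_surjective a
    change Ideal.Quotient.mk (J1 G) (act (1 : GL2 p) f) = Ideal.Quotient.mk (J1 G) f
    rw [map_one, AlgHom.one_apply]
  map_mul' g h := by
    refine LinearMap.ext fun a => ?_
    obtain ⟨f, rfl⟩ := Ideal.Quotient.mk_surjective a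
    change Ideal.Quotient.mk (J1 G) (act ((g : GL2 p) * (h : GL2 p)) f) =
      Ideal.Quotient.mk (J1 G) (act (g : GL2 p) (act (h : GL2 p) f))
    rw [map_mul, AlgHom.mul_apply]

/-- The action on classes: `g · [f] = [g · f]`. -/
theorem coinvRep_proj (G : Subgroup (GL2 p)) (g : G) (f : P p) :
    coinvRep G g (proj G f) = proj G (act (g : GL2 p) f) := rfl

/-- The homogeneous component of degree `n` of the coinvariant algebra. -/
noncomputable def component (G : Subgroup (GL2 p)) (n : ℕ) : Submodule (ZMod p) (Coinv G) :=
  (homogeneousSubmodule (Fin 2) (ZMod p) n).map (proj G).toLinearMap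

/-- The elements of positive degree in the coinvariant algebra: the sum of its homogeneous
components of positive degree. -/
noncomputable def positivePart (G : Subgroup (GL2 p)) : Submodule (ZMod p) (Coinv G) :=
  ⨆ n : ℕ, ⨆ _ : 0 < n, component G n

/-- The `𝔽_p`-vector space of `G`-invariant elements in the positive part of `P_G`. -/
noncomputable def positiveInvariants (G : Subgroup (GL2 p)) : Submodule (ZMod p) (Coinv G) :=
  positivePart G ⊓ (coinvRep G).invariants

/-- `a` is a fundamental class of `P_G`: a nonzero element spanning the homogeneous component
of highest degree. -/
def IsFundamentalClass (G : Subgroup (GL2 p)) (a : Coinv G) : Prop :=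
  a ≠ 0 ∧ ∃ d : ℕ, component G d = Submodule.span (ZMod p) {a} ∧ ∀ n : ℕ, d < n → component G n = ⊥

variable (p)

/-- The group `L^r` of all `A ∈ GL₂(𝔽_p)` such that `A^r` has determinant one. -/
def L (r : ℕ) : Subgroup (GL2 p) where
  carrier := {A | Matrix.GeneralLinearGroup.det (A ^ r) = 1}
  one_mem' := by simp
  mul_mem' {A B} hA hB := by
    simp only [Set.mem_ofPred_eq, map_pow] at hA hB ⊢
    rw [map_mul, mul_pow, hA, hB, one_mul]
  inv_mem' {A} hA := by
    simp only [Set.mem_ofPred_eq, map_pow] at hA ⊢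
    rw [map_inv, inv_pow, hA, inv_one]

/-- The polynomial `μ = x^(p-1) y^(p²-p)`. -/
noncomputable def mu : P p := x p ^ (p - 1) * y p ^ (p ^ 2 - p)

/-- The polynomial `γ_i = x^(i(p-1)) - x^(p-1) y^((i-1)(p-1)) + y^(i(p-1))`, for `i ≥ 1`. -/
noncomputable def gam (i : ℕ) : P p :=
  x p ^ (i * (p - 1)) - x p ^ (p - 1) * y p ^ ((i - 1) * (p - 1)) + y p ^ (i * (p - 1))

end CoinvGL2

namespace CoinvGL2

open MvPolynomial

variable {p : ℕ} [Fact p.Prime]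

/-! Write E for `eulerForm p` and d for `dickson p`. An invertible matrix A multiplies E by det A
and fixes d, and `J1_L` shows that the ideal of the group `L p r` is (E^r, d). Modulo E a form is
determined by its values on F_p^2, and d has value 1 at every nonzero vector, so P/(E, d) can be
studied through point values. Its top degree is p^2 - 1, spanned by `mu`; the sum of all values,
`evalSum`, detects that class and pairs complementary degrees.

The case r = 1 is `classification`, which needs invariance under SL_2 only. Below degree p(p-1) the
class d plays no role, so an invariant is constant on nonzero vectors, which leaves the multiples of
`gam p i`. From p(p-1) to just below the top degree, multiplication by an invariant followed by
`evalSum` is an SL_2-invariant functional on forms of some degree k with 1 ≤ k ≤ p - 1; such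
functionals vanish (`eq_zero_of_map_subst_eq`), and the pairing is nondegenerate. In the top degree
everything is invariant.

For r > 1 an invariant f is first shown to lie in (E, d), using invariance modulo (E^2, d). Euler's
formula `natCast_mul_eval_eq_zero` excludes the classes `gam p i`, whose degree is prime to p; `mu`
is excluded because E lies in the augmentation span of the forms of degree p + 1
(`map_eulerForm_eq_zero`). Powers of E are then peeled off: if f = g E^s + b d with s < r, then
modulo (E, d) the form g is SL_2-invariant, hence GL_2-invariant by the classification, yet the
group acts on it through det^(-s). A determinant ζ with ζ^r = 1 and ζ^s ≠ 1 forces g into (E, d). -/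

/-! ### Linear substitutions and homogeneous forms. -/

theorem subst_C (A : Matrix (Fin 2) (Fin 2) (ZMod p)) (a : ZMod p) : subst A (C a) = C a :=
  (subst A).commutes a

theorem subst_x (A : Matrix (Fin 2) (Fin 2) (ZMod p)) :
    subst A (x p) = C (A 0 0) * x p + C (A 1 0) * y p := by
  simp [subst_X]

theorem subst_y (A : Matrix (Fin 2) (Fin 2) (ZMod p)) :
    subst A (y p) = C (A 0 1) * x p + C (A 1 1) * y p := by
  simp [subst_X]

theorem eval_subst (A : Matrix (Fin 2) (Fin 2) (ZMod p)) (v : Fin 2 → ZMod p) (f : P p) :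
    eval v (subst A f) = eval (Matrix.vecMul v A) f := by
  induction f using MvPolynomial.induction_on with
  | C a => rw [subst_C, eval_C, eval_C]
  | add f g hf hg => rw [map_add, map_add, map_add, hf, hg]
  | mul_X f j hf =>
    rw [map_mul, map_mul, map_mul, hf, subst_X, eval_X]
    simp [Matrix.vecMul, dotProduct, mul_comm]

theorem isHomogeneous_monomial_xy (a b : ℕ) : (x p ^ a * y p ^ b).IsHomogeneous (a + b) :=
  (isHomogeneous_X_pow _ _).mul (isHomogeneous_X_pow _ _)

theorem isHomogeneous_monomial_xy' {a b n : ℕ} (h : a + b = n) :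
    (x p ^ a * y p ^ b).IsHomogeneous n := h ▸ isHomogeneous_monomial_xy a b

/-- Forms of degree `n` are linear combinations of monomials. -/
theorem mem_of_forall_monomial (S : Submodule (ZMod p) (P p)) {n : ℕ}
    (h : ∀ a b, a + b = n → x p ^ a * y p ^ b ∈ S) {f : P p} (hf : f.IsHomogeneous n) :
    f ∈ S := by
  rw [f.as_sum]
  refine Submodule.sum_mem _ fun m hm => ?_
  have h1 : m 0 + m 1 = n := by
    rw [hf.degree_eq_sum_deg_support hm, ← Finsupp.degree_apply, Finsupp.degree_eq_sum,
      Fin.sum_univ_two]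
  have h2 : monomial m (coeff m f) = coeff m f • (x p ^ m 0 * y p ^ m 1) := by
    rw [monomial_eq, smul_eq_C_mul, Finsupp.prod_fintype _ _ (by simp), Fin.prod_univ_two]
  rw [h2]
  exact S.smul_mem _ (h _ _ h1)

theorem isHomogeneous_subst {f : P p} {n : ℕ} (hf : f.IsHomogeneous n)
    (A : Matrix (Fin 2) (Fin 2) (ZMod p)) : (subst A f).IsHomogeneous n := by
  have h (u v : ZMod p) : (C u * x p + C v * y p).IsHomogeneous 1 :=
    (isHomogeneous_C_mul_X _ _).add (isHomogeneous_C_mul_X _ _)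
  refine mem_of_forall_monomial
    ((homogeneousSubmodule (Fin 2) (ZMod p) n).comap (subst A).toLinearMap) (fun a b hab => ?_) hf
  rw [Submodule.mem_comap, AlgHom.toLinearMap_apply, map_mul, map_pow, map_pow, subst_x, subst_y,
    mem_homogeneousSubmodule, ← hab]
  have := ((h (A 0 0) (A 1 0)).pow a).mul ((h (A 0 1) (A 1 1)).pow b)
  rwa [one_mul, one_mul] at this

/-- Scaling the arguments of a form. -/
theorem IsHomogeneous.aeval_mul {S : Type*} [CommRing S] [Algebra (ZMod p) S] {f : P p} {n : ℕ}
    (hf : f.IsHomogeneous n) (s a b : S) :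
    aeval ![s * a, s * b] f = s ^ n * aeval ![a, b] f := by
  let T : Submodule (ZMod p) (P p) :=
    LinearMap.eqLocus (aeval ![s * a, s * b] : P p →ₐ[ZMod p] S).toLinearMap
      (LinearMap.mulLeft (ZMod p) (s ^ n) ∘ₗ (aeval ![a, b] : P p →ₐ[ZMod p] S).toLinearMap)
  refine mem_of_forall_monomial T (fun i j h => ?_) hf
  simp only [T, LinearMap.mem_eqLocus, AlgHom.toLinearMap_apply, LinearMap.comp_apply,
    LinearMap.mulLeft_apply]
  subst h
  simp
  ring

theorem IsHomogeneous.eval_mul {f : P p} {n : ℕ}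
    (hf : f.IsHomogeneous n) (s a b : ZMod p) :
    eval ![s * a, s * b] f = s ^ n * eval ![a, b] f := by
  simpa [aeval_eq_eval] using IsHomogeneous.aeval_mul hf s a b

theorem homogeneousComponent_mul_of_le {f g : P p} {a n : ℕ} (hg : g.IsHomogeneous a) (h : a ≤ n) :
    homogeneousComponent n (f * g) = homogeneousComponent (n - a) f * g := by
  let := MvPolynomial.gradedAlgebra (R := ZMod p) (σ := Fin 2)
  have e (φ : P p) (i) : (DirectSum.decompose (homogeneousSubmodule (Fin 2) (ZMod p)) φ i : P p) =
      homogeneousComponent i φ := MvPolynomial.decomposition.decompose'_apply φ i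
  have h := DirectSum.coe_decompose_mul_of_right_mem_of_le (homogeneousSubmodule (Fin 2) (ZMod p))
    (a := f) ((mem_homogeneousSubmodule _ _).2 hg) h
  rwa [e, e] at h

theorem homogeneousComponent_mul_of_lt {f g : P p} {a n : ℕ} (hg : g.IsHomogeneous a) (h : n < a) :
    homogeneousComponent n (f * g) = 0 := by
  let := MvPolynomial.gradedAlgebra (R := ZMod p) (σ := Fin 2)
  have e (φ : P p) (i) : (DirectSum.decompose (homogeneousSubmodule (Fin 2) (ZMod p)) φ i : P p) =
      homogeneousComponent i φ := MvPolynomial.decomposition.decompose'_apply φ i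
  have h := DirectSum.coe_decompose_mul_of_right_mem_of_not_le
    (homogeneousSubmodule (Fin 2) (ZMod p)) (a := f) ((mem_homogeneousSubmodule _ _).2 hg)
    (not_le.2 h)
  rwa [e] at h

/-- The homogeneous components of a multiple of a form `g` are multiples of `g` by forms. -/
theorem exists_homogeneousComponent_mul (f : P p) {g : P p} {a : ℕ} (hg : g.IsHomogeneous a)
    (n : ℕ) : ∃ f' m, f'.IsHomogeneous m ∧ homogeneousComponent n (f * g) = f' * g ∧
      (a ≤ n → m + a = n) ∧ (n < a → f' = 0) := by
  rcases le_or_gt a n with h | h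
  · exact ⟨_, n - a, homogeneousComponent_isHomogeneous _ _, homogeneousComponent_mul_of_le hg h,
      fun _ => by omega, fun _ => by omega⟩
  · exact ⟨0, 0, isHomogeneous_zero _ _ _, by rw [homogeneousComponent_mul_of_lt hg h, zero_mul],
      fun _ => by omega, fun _ => rfl⟩

/-! ### The Euler class and the Dickson invariant. -/

variable (p) in
/-- The product of the linear forms, up to scalars: the Dickson-Euler class. -/
noncomputable def eulerForm : P p := x p ^ p * y p - x p * y p ^ p

variable (p) in
/-- The top Dickson invariant of degree `p² - p`. -/
noncomputable def dickson : P p :=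
  ∑ i ∈ Finset.range (p + 1), (x p ^ (p - 1)) ^ i * (y p ^ (p - 1)) ^ (p - i)

theorem isHomogeneous_eulerForm : (eulerForm p).IsHomogeneous (p + 1) := by
  refine IsHomogeneous.sub ?_ ?_
  · simpa using isHomogeneous_monomial_xy (p := p) p 1
  · simpa [add_comm] using isHomogeneous_monomial_xy (p := p) 1 p

theorem isHomogeneous_dickson : (dickson p).IsHomogeneous (p * (p - 1)) := by
  refine IsHomogeneous.sum _ _ _ fun i hi => ?_
  rw [← pow_mul, ← pow_mul]
  refine isHomogeneous_monomial_xy' ?_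
  have : i + (p - i) = p := by have := Finset.mem_range.1 hi; omega
  rw [← mul_add, this, mul_comm]

theorem dickson_mul_eulerForm :
    dickson p * eulerForm p = x p ^ p ^ 2 * y p - x p * y p ^ p ^ 2 := by
  have hp := (Fact.out : p.Prime).one_le
  have h := geom_sum₂_mul (x p ^ (p - 1)) (y p ^ (p - 1)) (p + 1)
  have h1 : eulerForm p = x p * y p * (x p ^ (p - 1) - y p ^ (p - 1)) := by
    obtain ⟨k, rfl⟩ : ∃ k, p = k + 1 := ⟨p - 1, by omega⟩
    simp only [eulerForm, Nat.add_sub_cancel]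
    ring
  have h2 : (p - 1) * (p + 1) + 1 = p ^ 2 := by
    obtain ⟨k, rfl⟩ : ∃ k, p = k + 1 := ⟨p - 1, by omega⟩
    simp; ring
  have h3 : dickson p = ∑ i ∈ Finset.range (p + 1),
      (x p ^ (p - 1)) ^ i * (y p ^ (p - 1)) ^ (p + 1 - 1 - i) := by simp [dickson]
  calc dickson p * eulerForm p = x p * y p * ((∑ i ∈ Finset.range (p + 1),
      (x p ^ (p - 1)) ^ i * (y p ^ (p - 1)) ^ (p + 1 - 1 - i)) *
        (x p ^ (p - 1) - y p ^ (p - 1))) := by rw [h1, h3]; ring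
    _ = _ := by
      rw [h, ← h2]; ring

/-- Frobenius is additive and fixes the coefficients, so (x^p, y^p) transforms by A just as (x, y)
does; the Euler class is the 2 × 2 determinant of these two rows. -/
theorem subst_eulerForm (A : Matrix (Fin 2) (Fin 2) (ZMod p)) :
    subst A (eulerForm p) = C A.det * eulerForm p := by
  simp only [eulerForm, map_sub, map_mul, map_pow, subst_x, subst_y, add_pow_char, mul_pow,
    ← C_pow, ZMod.pow_card, Matrix.det_fin_two]
  ring

theorem eulerForm_ne_zero : eulerForm p ≠ 0 := by
  intro h
  have h1 : coeff (Finsupp.single 0 p + Finsupp.single 1 1) (eulerForm p) = 1 := by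
    have e1 : x p ^ p * y p = monomial (Finsupp.single 0 p + Finsupp.single 1 1) 1 := by
      rw [← mul_one (1 : ZMod p), ← monomial_mul, ← X_pow_eq_monomial]; rfl
    have e2 : x p * y p ^ p = monomial (Finsupp.single 0 1 + Finsupp.single 1 p) 1 := by
      rw [← mul_one (1 : ZMod p), ← monomial_mul, ← X_pow_eq_monomial, ← X_pow_eq_monomial,
        pow_one]
    rw [eulerForm, e1, e2, coeff_sub, coeff_monomial, coeff_monomial, if_pos rfl, if_neg, sub_zero]
    intro h
    have := DFunLike.congr_fun h 0
    simp at this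
    exact (Fact.out : p.Prime).one_lt.ne this
  rw [h] at h1
  simp at h1

/-- The product d E is the same kind of determinant with p^2 in place of p, so it is also multiplied
by det A; cancelling the factor of E leaves d fixed. -/
theorem subst_dickson {A : Matrix (Fin 2) (Fin 2) (ZMod p)} (hA : A.det ≠ 0) :
    subst A (dickson p) = dickson p := by
  have h : subst A (dickson p * eulerForm p) = C A.det * (dickson p * eulerForm p) := by
    rw [dickson_mul_eulerForm]
    have e (a : ZMod p) : a ^ p ^ 2 = a := by rw [sq, pow_mul, ZMod.pow_card, ZMod.pow_card]
    simp only [map_sub, map_mul, map_pow, subst_x, subst_y, add_pow_char_pow, mul_pow,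
      ← C_pow, e, Matrix.det_fin_two]
    ring
  rw [map_mul, subst_eulerForm] at h
  have h1 : C A.det * eulerForm p ≠ 0 :=
    mul_ne_zero (by simpa using hA) eulerForm_ne_zero
  refine mul_right_cancel₀ h1 ?_
  rw [h]; ring

theorem eval_eulerForm (v : Fin 2 → ZMod p) : eval v (eulerForm p) = 0 := by
  simp [eulerForm]

theorem eval_dickson_one_zero : eval ![1, 0] (dickson p) = 1 := by
  have hp := (Fact.out : p.Prime).one_lt
  have : p - 1 ≠ 0 := by omega
  simp only [dickson, map_sum, map_mul, map_pow, eval_X, Matrix.cons_val_zero, Matrix.cons_val_one,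
    one_pow, one_mul, zero_pow this]
  rw [Finset.sum_eq_single p]
  · simp
  · intro b hb hb'
    have := Finset.mem_range.1 hb
    exact zero_pow (by omega)
  · simp

theorem eval_dickson_one (t : ZMod p) : eval ![t, 1] (dickson p) = 1 := by
  have hp := (Fact.out : p.Prime).one_lt
  have : p - 1 ≠ 0 := by omega
  simp only [dickson, map_sum, map_mul, map_pow, eval_X, Matrix.cons_val_zero, Matrix.cons_val_one,
    one_pow, mul_one]
  by_cases ht : t = 0
  · subst ht
    rw [Finset.sum_eq_single 0]
    · simp
    · intro b _ hb'
      rw [zero_pow this, zero_pow hb']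
    · simp
  · simp [ZMod.pow_card_sub_one_eq_one ht]

/-! ### Forms modulo the Euler class, as functions on the projective line. -/

/-- A form is, modulo the Euler class, a combination of `x ^ n` and the monomials
`x ^ a * y ^ (n - a)` with `a < min p n`. -/
theorem exists_normalForm {f : P p} {n : ℕ} (hf : f.IsHomogeneous n) :
    ∃ (α : ZMod p) (c : ℕ → ZMod p), eulerForm p ∣ f - (C α * x p ^ n +
      ∑ a ∈ Finset.range (min p n), C (c a) * (x p ^ a * y p ^ (n - a))) := by
  let S : Submodule (ZMod p) (P p) :=
    { carrier := {f | ∃ (α : ZMod p) (c : ℕ → ZMod p), eulerForm p ∣ f - (C α * x p ^ n +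
        ∑ a ∈ Finset.range (min p n), C (c a) * (x p ^ a * y p ^ (n - a)))}
      add_mem' := by
        rintro f g ⟨α, c, h⟩ ⟨β, d, h'⟩
        refine ⟨α + β, c + d, ?_⟩
        convert dvd_add h h' using 1
        simp only [Pi.add_apply, map_add, add_mul, Finset.sum_add_distrib]
        ring
      zero_mem' := ⟨0, 0, by simp⟩
      smul_mem' := by
        rintro s f ⟨α, c, h⟩
        refine ⟨s * α, fun a => s * c a, ?_⟩
        convert h.mul_left (C s) using 1
        simp only [smul_eq_C_mul, map_mul, mul_sub, mul_add, Finset.mul_sum, mul_assoc] }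
  have key : ∀ a b, a + b = n → x p ^ a * y p ^ b ∈ S := by
    intro a
    induction a using Nat.strong_induction_on with
    | _ a ih =>
      intro b hab
      have hp := (Fact.out : p.Prime).one_lt
      rcases Nat.eq_zero_or_pos b with rfl | hb
      · refine ⟨1, 0, ?_⟩
        simp at hab
        simp [hab]
      · rcases lt_or_ge a p with h | h
        · refine ⟨0, Pi.single a 1, ?_⟩
          rw [Finset.sum_eq_single a]
          · have : n - a = b := by omega
            simp [this]
          · intro i _ hi
            simp [hi]
          · intro h'
            exact absurd (Finset.mem_range.2 (by omega)) h'
        -- Modulo E, x^p y = x y^p: as long as b > 0, p - 1 factors can be moved from x to y.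
        · obtain ⟨α, c, h'⟩ := ih (a - (p - 1)) (by omega) (b + (p - 1)) (by omega)
          refine ⟨α, c, ?_⟩
          have h2 : eulerForm p ∣ x p ^ a * y p ^ b -
              x p ^ (a - (p - 1)) * y p ^ (b + (p - 1)) := by
            refine ⟨x p ^ (a - p) * y p ^ (b - 1), ?_⟩
            obtain ⟨a', rfl⟩ : ∃ k, a = p + k := ⟨a - p, by omega⟩
            obtain ⟨b', rfl⟩ : ∃ k, b = k + 1 := ⟨b - 1, by omega⟩
            have e1 : p + a' - (p - 1) = a' + 1 := by omega
            have e2 : b' + 1 + (p - 1) = p + b' := by omega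
            rw [e1, e2, eulerForm]
            simp only [Nat.add_sub_cancel, Nat.add_sub_cancel_left]
            ring
          convert dvd_add h2 h' using 1
          ring
  exact mem_of_forall_monomial S key hf

/-- A form vanishing on the projective line over `𝔽_p` is a multiple of the Euler class. -/
theorem eulerForm_dvd {f : P p} {n : ℕ} (hf : f.IsHomogeneous n) (h0 : eval ![1, 0] f = 0)
    (h1 : ∀ t, eval ![t, 1] f = 0) : eulerForm p ∣ f := by
  obtain ⟨α, c, g, hg⟩ := exists_normalForm hf
  have hα : α = 0 := by
    have := congr_arg (eval ![1, 0]) hg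
    have h3 : ∑ a ∈ Finset.range (min p n), c a * 0 ^ (n - a) = 0 := by
      refine Finset.sum_eq_zero fun a ha => ?_
      have := Finset.mem_range.1 ha
      rw [zero_pow (by omega), mul_zero]
    simpa [h0, eval_eulerForm, h3] using this
  subst hα
  -- On the affine line the normal form is a one-variable polynomial of degree less than p with p
  -- zeros.
  have hc : ∀ a ∈ Finset.range (min p n), c a = 0 := by
    let q : Polynomial (ZMod p) :=
      ∑ a ∈ Finset.range (min p n), Polynomial.C (c a) * Polynomial.X ^ a
    have hq : q = 0 := by
      refine Polynomial.eq_zero_of_natDegree_lt_card_of_eval_eq_zero q Function.injective_id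
        (fun t => ?_) ?_
      · have := congr_arg (eval ![t, 1]) hg
        simp [h1, eval_eulerForm] at this
        simpa [q, Polynomial.eval_finsetSum] using this
      · rw [ZMod.card]
        refine lt_of_le_of_lt (Polynomial.natDegree_sum_le_of_forall_le (n := p - 1) _ _
          fun a ha => (Polynomial.natDegree_C_mul_X_pow_le _ _).trans ?_) ?_
        · have := Finset.mem_range.1 ha; omega
        · have := (Fact.out : p.Prime).pos; omega
    intro a ha
    have := congr_arg (fun q => Polynomial.coeff q a) hq
    simp only [q, Polynomial.finsetSum_coeff, Polynomial.coeff_C_mul_X_pow,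
      Polynomial.coeff_zero] at this
    rw [Finset.sum_ite_eq, if_pos ha] at this
    exact this
  rw [Finset.sum_eq_zero (fun a ha => by rw [hc a ha]; simp)] at hg
  exact ⟨g, by simpa using hg⟩

/-! ### The ideals (E^s, d) and normal forms in large degree. -/

variable (p) in
/-- The ideal generated by the `s`-th power of the Euler class and the Dickson invariant. -/
noncomputable def dicksonIdeal (s : ℕ) : Ideal (P p) := Ideal.span {eulerForm p ^ s, dickson p}

theorem mem_dicksonIdeal {s : ℕ} {f : P p} :
    f ∈ dicksonIdeal p s ↔ ∃ a b, a * eulerForm p ^ s + b * dickson p = f :=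
  Ideal.mem_span_pair

theorem dickson_mem (s : ℕ) : dickson p ∈ dicksonIdeal p s :=
  Ideal.subset_span (by simp)

theorem eulerForm_pow_mem (s : ℕ) : eulerForm p ^ s ∈ dicksonIdeal p s :=
  Ideal.subset_span (by simp)

theorem mem_dicksonIdeal_of_dvd {s : ℕ} {f : P p} (h : eulerForm p ^ s ∣ f) :
    f ∈ dicksonIdeal p s :=
  Ideal.mem_of_dvd _ h (eulerForm_pow_mem s)

theorem mem_dicksonIdeal_one_of_dvd {f : P p} (h : eulerForm p ∣ f) : f ∈ dicksonIdeal p 1 :=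
  mem_dicksonIdeal_of_dvd (by simpa using h)

theorem dicksonIdeal_anti {s t : ℕ} (h : s ≤ t) : dicksonIdeal p t ≤ dicksonIdeal p s := by
  refine Ideal.span_le.2 ?_
  rintro f (rfl | rfl)
  · exact mem_dicksonIdeal_of_dvd (pow_dvd_pow _ h)
  · exact dickson_mem s

theorem subst_mem {s : ℕ} {A : Matrix (Fin 2) (Fin 2) (ZMod p)} (hA : A.det ≠ 0) {f : P p}
    (hf : f ∈ dicksonIdeal p s) : subst A f ∈ dicksonIdeal p s := by
  obtain ⟨a, b, rfl⟩ := mem_dicksonIdeal.1 hf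
  rw [map_add, map_mul, map_mul, map_pow, subst_eulerForm, subst_dickson hA, mul_pow]
  exact add_mem (Ideal.mul_mem_left _ _ (Ideal.mul_mem_left _ _ (eulerForm_pow_mem s)))
    (Ideal.mul_mem_left _ _ (dickson_mem s))

theorem exists_isHomogeneous_of_mem {s n : ℕ} {f : P p} (hf : f.IsHomogeneous n)
    (h : f ∈ dicksonIdeal p s) : ∃ u v i j, u.IsHomogeneous i ∧ v.IsHomogeneous j ∧
      f = u * eulerForm p ^ s + v * dickson p ∧ (p * (p - 1) ≤ n → j + p * (p - 1) = n) ∧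
      (n < p * (p - 1) → v = 0) := by
  obtain ⟨a, b, hab⟩ := mem_dicksonIdeal.1 h
  obtain ⟨u, i, hu, hu', -⟩ := exists_homogeneousComponent_mul a (isHomogeneous_eulerForm.pow s) n
  obtain ⟨v, j, hv, hv', h1, h2⟩ := exists_homogeneousComponent_mul b isHomogeneous_dickson n
  refine ⟨u, v, i, j, hu, hv, ?_, h1, h2⟩
  rw [← hu', ← hv', ← map_add, hab, homogeneousComponent_eq_self hf]

/-- In degrees below that of the Dickson invariant, only the Euler class matters. -/
theorem eulerForm_pow_dvd_of_mem {s n : ℕ} {f : P p} (hf : f.IsHomogeneous n)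
    (hn : n < p * (p - 1)) (h : f ∈ dicksonIdeal p s) : eulerForm p ^ s ∣ f := by
  obtain ⟨u, v, -, -, -, -, h, -, h'⟩ := exists_isHomogeneous_of_mem hf h
  rw [h' hn, zero_mul, add_zero] at h
  exact ⟨u, by rw [h, mul_comm]⟩

theorem two_le_p : 2 ≤ p := (Fact.out : p.Prime).two_le

theorem le_mul_pred : p ≤ p * (p - 1) :=
  Nat.le_mul_of_pos_right _ (by have := two_le_p (p := p); omega)

theorem eval_monomial_xy (v : Fin 2 → ZMod p) (a b : ℕ) :
    eval v (x p ^ a * y p ^ b) = v 0 ^ a * v 1 ^ b := by simp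

/-- Standard monomials span the forms of large degree modulo the ideal. -/
theorem exists_normalForm_of_le {f : P p} {m n : ℕ} (hf : f.IsHomogeneous n)
    (hn : n = m + p * (p - 1)) : ∃ c : ℕ → ZMod p, (∀ a < m, c a = 0) ∧
      f - ∑ a ∈ Finset.range p, C (c a) * (x p ^ a * y p ^ (n - a)) ∈ dicksonIdeal p 1 := by
  have hpn : p ≤ n := by have := le_mul_pred (p := p); omega
  -- Since d has value 1 at (1, 0), subtracting this multiple of d removes the value of f there, and
  -- with it the x^n term.
  have hxd : (C (eval ![1, 0] f) * (x p ^ m * dickson p)).IsHomogeneous n := by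
    rw [hn]; exact ((isHomogeneous_X_pow _ _).mul isHomogeneous_dickson).C_mul _
  obtain ⟨α, c, hc⟩ := exists_normalForm (hf.sub hxd)
  rw [min_eq_left hpn] at hc
  have hα : α = 0 := by
    obtain ⟨g, hg⟩ := hc
    have := congr_arg (eval ![1, 0]) hg
    have h3 : ∑ a ∈ Finset.range p, c a * 0 ^ (n - a) = 0 := by
      refine Finset.sum_eq_zero fun a ha => ?_
      have := Finset.mem_range.1 ha
      rw [zero_pow (by omega), mul_zero]
    simpa [eval_eulerForm, h3, eval_dickson_one_zero] using this
  subst hα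
  -- For a < m the monomial has the same values as x^a y^(m-a) d, so it is a multiple of d modulo E.
  have hlow : ∀ a < m, a < p → x p ^ a * y p ^ (n - a) ∈ dicksonIdeal p 1 := by
    intro a ha hap
    have h1 : eulerForm p ∣ x p ^ a * y p ^ (n - a) - x p ^ a * y p ^ (m - a) * dickson p := by
      refine eulerForm_dvd (n := n) ((isHomogeneous_monomial_xy' (by omega)).sub ?_) ?_ ?_
      · rw [hn]
        exact (isHomogeneous_monomial_xy' (by omega)).mul isHomogeneous_dickson
      · rw [map_sub, map_mul _ (_ * _), eval_monomial_xy, eval_monomial_xy]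
        have h1 : n - a ≠ 0 := by omega
        have h2 : m - a ≠ 0 := by omega
        simp [h1, h2]
      · intro t
        rw [map_sub, map_mul _ (_ * _), eval_monomial_xy, eval_monomial_xy, eval_dickson_one]
        simp
    have := add_mem (mem_dicksonIdeal_one_of_dvd h1)
      (Ideal.mul_mem_left _ (x p ^ a * y p ^ (m - a)) (dickson_mem (p := p) 1))
    simpa using this
  refine ⟨fun a => if a < m then 0 else c a, fun a ha => if_pos ha, ?_⟩
  have e : f - ∑ a ∈ Finset.range p, C (if a < m then 0 else c a) * (x p ^ a * y p ^ (n - a)) =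
      (f - C (eval ![1, 0] f) * (x p ^ m * dickson p) - (C 0 * x p ^ n +
        ∑ a ∈ Finset.range p, C (c a) * (x p ^ a * y p ^ (n - a)))) +
      C (eval ![1, 0] f) * x p ^ m * dickson p +
      ∑ a ∈ Finset.range p, (C (c a) - C (if a < m then 0 else c a)) *
        (x p ^ a * y p ^ (n - a)) := by
    simp only [sub_mul, Finset.sum_sub_distrib, map_zero]
    ring
  rw [e]
  refine add_mem (add_mem (mem_dicksonIdeal_one_of_dvd hc)
    (Ideal.mul_mem_left _ _ (dickson_mem 1))) (sum_mem fun a ha => ?_)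
  split_ifs with h
  · exact Ideal.mul_mem_left _ _ (hlow a h (Finset.mem_range.1 ha))
  · simp

theorem mul_pred_add : p + p * (p - 1) = p ^ 2 := by
  obtain ⟨k, hk⟩ : ∃ k, p = k + 1 := ⟨p - 1, by have := two_le_p (p := p); omega⟩
  rw [hk]; simp; ring

theorem top_degree_eq : (p - 1) + p * (p - 1) = p ^ 2 - 1 := by
  have := mul_pred_add (p := p)
  have := two_le_p (p := p)
  omega

theorem sq_sub_self : p ^ 2 - p = p * (p - 1) := by
  have := mul_pred_add (p := p)
  omega

theorem top_degree_eq_mul : p ^ 2 - 1 = (p + 1) * (p - 1) := by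
  rw [← top_degree_eq]; ring

/-- Here m ≥ p in the normal form, so none of the exponents m ≤ a < p remains. -/
theorem mem_dicksonIdeal_one_of_sq_le {f : P p} {n : ℕ} (hf : f.IsHomogeneous n)
    (hn : p ^ 2 ≤ n) : f ∈ dicksonIdeal p 1 := by
  have h := mul_pred_add (p := p)
  obtain ⟨c, h0, hc⟩ := exists_normalForm_of_le hf (m := n - p * (p - 1)) (by omega)
  rwa [Finset.sum_eq_zero, sub_zero] at hc
  intro a ha
  have := Finset.mem_range.1 ha
  rw [h0 a (by omega)]
  simp

theorem isHomogeneous_mu : (mu p).IsHomogeneous (p ^ 2 - 1) :=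
  isHomogeneous_monomial_xy' (by rw [sq_sub_self, top_degree_eq])

theorem exists_sub_mu_mem {f : P p} (hf : f.IsHomogeneous (p ^ 2 - 1)) :
    ∃ c, f - C c * mu p ∈ dicksonIdeal p 1 := by
  obtain ⟨c, h0, hc⟩ := exists_normalForm_of_le hf (m := p - 1) top_degree_eq.symm
  refine ⟨c (p - 1), ?_⟩
  have h2 := two_le_p (p := p)
  rw [Finset.sum_eq_single (p - 1)] at hc
  · have h1 : p ^ 2 - 1 - (p - 1) = p ^ 2 - p := by omega
    rwa [h1] at hc
  · intro a ha ha'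
    have := Finset.mem_range.1 ha
    rw [h0 a (by omega)]
    simp
  · intro h
    exact absurd (Finset.mem_range.2 (by omega)) h

/-! ### The top class and the duality pairing given by summing values. -/

/-- The sum of the values of a polynomial. -/
noncomputable def evalSum : P p →ₗ[ZMod p] ZMod p :=
  ∑ v : Fin 2 → ZMod p, (aeval v : P p →ₐ[ZMod p] ZMod p).toLinearMap

theorem evalSum_apply (f : P p) : evalSum f = ∑ v : Fin 2 → ZMod p, eval v f := by
  simp [evalSum, aeval_eq_eval]

theorem sum_pow_eq (s : ℕ) : ∑ t : ZMod p, t ^ s = if 0 < s ∧ p - 1 ∣ s then -1 else 0 := by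
  rcases Nat.eq_zero_or_pos s with rfl | hs
  · simp
  · have h := FiniteField.sum_pow_units (ZMod p) s
    rw [ZMod.card] at h
    simp only [hs, true_and]
    rw [← h, ← Fintype.sum_subtype_add_sum_subtype (fun t : ZMod p => t ≠ 0)]
    have h2 : ∑ i : {t : ZMod p // ¬ t ≠ 0}, (i : ZMod p) ^ s = 0 :=
      Finset.sum_eq_zero fun i _ => by rw [not_not.1 i.2, zero_pow hs.ne']
    rw [h2, add_zero]
    exact (Fintype.sum_equiv unitsEquivNeZero _ _ fun _ => rfl).symm

theorem evalSum_monomial (a b : ℕ) :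
    evalSum (x p ^ a * y p ^ b) = (∑ t : ZMod p, t ^ a) * ∑ t : ZMod p, t ^ b := by
  rw [evalSum_apply, Finset.sum_mul_sum, ← Fintype.sum_prod_type']
  refine Fintype.sum_equiv (finTwoArrowEquiv _) _ _ fun v => ?_
  rw [eval_monomial_xy]; rfl

theorem evalSum_monomial_top {a b : ℕ} (h : a + b = p ^ 2 - 1) (hb : 0 < b) :
    evalSum (x p ^ a * y p ^ b) = if 0 < a ∧ p - 1 ∣ a then 1 else 0 := by
  rw [evalSum_monomial, sum_pow_eq, sum_pow_eq]
  by_cases ha : 0 < a ∧ p - 1 ∣ a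
  · have : p - 1 ∣ b := by
      rw [← Nat.dvd_add_right ha.2, h, top_degree_eq_mul]
      exact dvd_mul_left _ _
    simp [ha, hb, this]
  · simp [ha]

theorem evalSum_mu : evalSum (mu p) = 1 := by
  have h2 := two_le_p (p := p)
  rw [mu, evalSum_monomial_top, if_pos ⟨by omega, dvd_rfl⟩]
  · rw [sq_sub_self, top_degree_eq]
  · rw [sq_sub_self]
    exact lt_of_lt_of_le (by omega) le_mul_pred

theorem IsHomogeneous.eval_zero {f : P p} {n : ℕ} (hf : f.IsHomogeneous n) (hn : n ≠ 0) :
    eval 0 f = 0 := by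
  have e : (0 : Fin 2 → ZMod p) = ![0 * 0, 0 * 0] := by ext i; fin_cases i <;> simp
  rw [e, IsHomogeneous.eval_mul hf, zero_pow hn, zero_mul]

theorem eval_eq_of_forall {f : P p} {i : ℕ} (hf : f.IsHomogeneous (i * (p - 1))) {c : ZMod p}
    (h0 : eval ![1, 0] f = c) (h1 : ∀ t, eval ![t, 1] f = c) {v : Fin 2 → ZMod p} (hv : v ≠ 0) :
    eval v f = c := by
  have hpow {s : ZMod p} (hs : s ≠ 0) : s ^ (i * (p - 1)) = 1 := by
    rw [mul_comm, pow_mul, ZMod.pow_card_sub_one_eq_one hs, one_pow]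
  by_cases hv1 : v 1 = 0
  · have hv0 : v 0 ≠ 0 := fun h0 => hv (by ext i; fin_cases i <;> simp [h0, hv1])
    have e : v = ![v 0 * 1, v 0 * 0] := by ext i; fin_cases i <;> simp [hv1]
    rw [e, IsHomogeneous.eval_mul hf, h0, hpow hv0, one_mul]
  · have e : v = ![v 1 * (v 0 / v 1), v 1 * 1] := by
      ext i; fin_cases i <;> simp [mul_div_cancel₀ _ hv1]
    rw [e, IsHomogeneous.eval_mul hf, h1, hpow hv1, one_mul]

theorem eval_dickson {v : Fin 2 → ZMod p} (hv : v ≠ 0) : eval v (dickson p) = 1 :=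
  eval_eq_of_forall isHomogeneous_dickson eval_dickson_one_zero eval_dickson_one hv

theorem evalSum_eq_zero_of_pred {f : P p} (hf : f.IsHomogeneous (p - 1)) : evalSum f = 0 := by
  have h2 := two_le_p (p := p)
  refine mem_of_forall_monomial (LinearMap.ker evalSum) (fun a b hab => ?_) hf
  rw [LinearMap.mem_ker, evalSum_monomial, sum_pow_eq, sum_pow_eq]
  by_cases h : 0 < a ∧ p - 1 ∣ a
  · have := Nat.le_of_dvd h.1 h.2
    have : b = 0 := by omega
    simp [this]
  · simp [h]

/-- Summing values kills multiples of E and does not see the factor d, which is 1 off the origin.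
What remains is the sum of values of a form of degree p - 1, too small for both exponents of a
monomial to be positive multiples of p - 1. -/
theorem evalSum_eq_zero_of_mem {f : P p} (hf : f.IsHomogeneous (p ^ 2 - 1))
    (h : f ∈ dicksonIdeal p 1) : evalSum f = 0 := by
  have h2 := two_le_p (p := p)
  obtain ⟨u, v, i, j, -, hv, rfl, hj, -⟩ := exists_isHomogeneous_of_mem hf h
  have hj : j = p - 1 := by
    have := top_degree_eq (p := p)
    have := hj (by omega)
    omega
  subst hj
  have e : evalSum (u * eulerForm p ^ 1 + v * dickson p) = evalSum v := by
    rw [evalSum_apply, evalSum_apply]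
    refine Finset.sum_congr rfl fun w _ => ?_
    rw [map_add, map_mul, map_mul, map_pow, eval_eulerForm]
    by_cases hw : w = 0
    · rw [hw, IsHomogeneous.eval_zero hv (by omega)]
      simp
    · simp [eval_dickson hw]
  rw [e, evalSum_eq_zero_of_pred hv]

theorem evalSum_subst {A : Matrix (Fin 2) (Fin 2) (ZMod p)} (hA : A.det ≠ 0) (f : P p) :
    evalSum (subst A f) = evalSum f := by
  rw [evalSum_apply, evalSum_apply]
  simp_rw [eval_subst]
  have hinj : Function.Injective fun v : Fin 2 → ZMod p => Matrix.vecMul v A :=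
    Matrix.vecMul_injective_of_isUnit ((Matrix.isUnit_iff_isUnit_det A).2 hA.isUnit)
  exact Fintype.sum_bijective _ (Finite.injective_iff_bijective.1 hinj) _ _ fun _ => rfl

theorem C_mul_mu_mem {c : ZMod p} (h : C c * mu p ∈ dicksonIdeal p 1) : c = 0 := by
  have := evalSum_eq_zero_of_mem (isHomogeneous_mu.C_mul c) h
  rwa [← smul_eq_C_mul, map_smul, evalSum_mu, smul_eq_mul, mul_one] at this

/-- Forms of the top degree are invariant modulo the ideal. -/
theorem subst_sub_mem_of_top {A : Matrix (Fin 2) (Fin 2) (ZMod p)} (hA : A.det ≠ 0) {f : P p}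
    (hf : f.IsHomogeneous (p ^ 2 - 1)) : subst A f - f ∈ dicksonIdeal p 1 := by
  obtain ⟨c, hc⟩ := exists_sub_mu_mem ((isHomogeneous_subst hf A).sub hf)
  have h := evalSum_eq_zero_of_mem (((isHomogeneous_subst hf A).sub hf).sub
    (isHomogeneous_mu.C_mul c)) hc
  rw [map_sub, map_sub, evalSum_subst hA, sub_self, ← smul_eq_C_mul, map_smul, evalSum_mu] at h
  have : c = 0 := by simpa using h
  simpa [this] using hc

/-- Perfectness of the pairing into the top degree. -/
theorem mem_dicksonIdeal_of_evalSum_mul {f : P p} {k m n : ℕ} (hf : f.IsHomogeneous n)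
    (hn : n = m + p * (p - 1)) (hk : k + m = p - 1) (hk0 : 0 < k)
    (h : ∀ a b, a + b = k → evalSum (f * (x p ^ a * y p ^ b)) = 0) : f ∈ dicksonIdeal p 1 := by
  have h2 := two_le_p (p := p)
  have hpq := le_mul_pred (p := p)
  have htop := top_degree_eq (p := p)
  obtain ⟨c, h0, hc⟩ := exists_normalForm_of_le hf hn
  -- The normal form of f is paired with x^b y^(k-b); only exponents a + b that are positive
  -- multiples of p - 1 contribute.
  have key : ∀ b ≤ k, ∑ a ∈ Finset.range p,
      c a * (if 0 < a + b ∧ p - 1 ∣ a + b then 1 else 0) = 0 := by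
    intro b hb
    have hsum : (∑ a ∈ Finset.range p, C (c a) * (x p ^ a * y p ^ (n - a))).IsHomogeneous n :=
      IsHomogeneous.sum _ _ _ fun a ha => (isHomogeneous_monomial_xy' (by
        have := Finset.mem_range.1 ha; omega)).C_mul _
    have hhom := (hf.sub hsum).mul
      (isHomogeneous_monomial_xy' (show b + (k - b) = k by omega))
    rw [show n + k = p ^ 2 - 1 by omega] at hhom
    have e1 := evalSum_eq_zero_of_mem hhom
      (Ideal.mul_mem_right (x p ^ b * y p ^ (k - b)) _ hc)
    rw [sub_mul, map_sub, h b (k - b) (by omega), zero_sub, neg_eq_zero, Finset.sum_mul,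
      map_sum] at e1
    refine Eq.trans (Finset.sum_congr rfl fun a ha => ?_) e1
    have := Finset.mem_range.1 ha
    have e2 : C (c a) * (x p ^ a * y p ^ (n - a)) * (x p ^ b * y p ^ (k - b)) =
        c a • (x p ^ (a + b) * y p ^ (n - a + (k - b))) := by
      rw [smul_eq_C_mul]; ring
    rw [e2, map_smul, evalSum_monomial_top (by omega) (by omega), smul_eq_mul]
  -- The choice b = p - 1 - a isolates c a: the next multiple 2(p - 1) would need the exponent p - 1
  -- + a, which is out of range as a > 0.
  have hpos : ∀ a, 0 < a → a < p → c a = 0 := by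
    intro a ha hap
    by_cases ham : a < m
    · exact h0 a ham
    have := key (p - 1 - a) (by omega)
    rw [Finset.sum_eq_single a] at this
    · have e : a + (p - 1 - a) = p - 1 := by omega
      rw [e, if_pos ⟨by omega, dvd_rfl⟩, mul_one] at this
      exact this
    · intro i hi hia
      have := Finset.mem_range.1 hi
      rw [if_neg, mul_zero]
      rintro ⟨h1, d, hd⟩
      rcases d with _ | _ | d
      · omega
      · omega
      · have : 2 * (p - 1) ≤ (p - 1) * (d + 1 + 1) := by nlinarith
        omega
    · intro h
      exact absurd (Finset.mem_range.2 hap) h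
  -- When m = 0 and b = k = p - 1, both exponents 0 and p - 1 contribute, and the coefficient of the
  -- latter is already known to vanish.
  have hzero : c 0 = 0 := by
    rcases Nat.eq_zero_or_pos m with rfl | hm
    · have := key k le_rfl
      rw [Finset.sum_eq_single 0] at this
      · rw [zero_add, if_pos ⟨hk0, by rw [← hk]; simp⟩, mul_one] at this
        exact this
      · intro i hi hi0
        rw [hpos i (by omega) (Finset.mem_range.1 hi), zero_mul]
      · intro h
        exact absurd (Finset.mem_range.2 (by omega)) h
    · exact h0 0 hm
  rwa [Finset.sum_eq_zero, sub_zero] at hc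
  intro a ha
  have : c a = 0 := by
    rcases Nat.eq_zero_or_pos a with rfl | h
    · exact hzero
    · exact hpos a h (Finset.mem_range.1 ha)
  simp [this]

/-- Every form of degree p^2 lies in (E, d), so a common divisor divides both x^(p^2) and y^(p^2).
-/
theorem isRelPrime_eulerForm_dickson : IsRelPrime (eulerForm p) (dickson p) := by
  intro z hz hz'
  have hxy : IsRelPrime (x p) (y p) := by
    refine X_prime.irreducible.isRelPrime_iff_not_dvd.2 fun h => ?_
    exact absurd (X_dvd_X.1 h) (by decide)
  have key (f : P p) (hf : f.IsHomogeneous (p ^ 2)) : z ∣ f := by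
    obtain ⟨a, b, rfl⟩ := mem_dicksonIdeal.1 (mem_dicksonIdeal_one_of_sq_le hf le_rfl)
    exact dvd_add ((pow_one (eulerForm p) ▸ hz).mul_left _) (hz'.mul_left _)
  exact (hxy.pow (m := p ^ 2) (n := p ^ 2)) (key _ (isHomogeneous_X_pow _ _))
    (key _ (isHomogeneous_X_pow _ _))

/-- The Euler class is a nonzerodivisor modulo the Dickson invariant. -/
theorem mem_of_mul_eulerForm_pow_mem {j : ℕ} {f : P p}
    (h : f * eulerForm p ^ j ∈ dicksonIdeal p (j + 1)) : f ∈ dicksonIdeal p 1 := by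
  obtain ⟨u, v, huv⟩ := mem_dicksonIdeal.1 h
  have h1 : eulerForm p ^ j ∣ v * dickson p :=
    ⟨f - u * eulerForm p, by linear_combination huv⟩
  obtain ⟨w, rfl⟩ := isRelPrime_eulerForm_dickson.pow_left.dvd_of_dvd_mul_right h1
  refine mem_dicksonIdeal.2 ⟨u, w, ?_⟩
  refine mul_right_cancel₀ (pow_ne_zero j eulerForm_ne_zero) ?_
  linear_combination huv

/-! ### Invariant functionals and Euler's formula. -/

theorem map_mul_add_pow {M : Type*} [AddCommGroup M] [Module (ZMod p) M] (φ : P p →ₗ[ZMod p] M)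
    (i j : ℕ) : φ (x p ^ i * (x p + y p) ^ j) = ∑ m ∈ Finset.range (j + 1),
      (j.choose m : ZMod p) • φ (x p ^ (i + (j - m)) * y p ^ m) := by
  rw [add_comm (x p), add_pow, Finset.mul_sum, map_sum]
  refine Finset.sum_congr rfl fun m _ => ?_
  rw [← map_smul]
  congr 1
  rw [smul_eq_C_mul, map_natCast, pow_add]
  ring

/-- The forms of degree `1 ≤ k ≤ p - 1` have no coinvariants under `SL₂`. -/
theorem eq_zero_of_map_subst_eq {M : Type*} [AddCommGroup M] [Module (ZMod p) M]
    (φ : P p →ₗ[ZMod p] M) {k : ℕ} (hk0 : 0 < k) (hk : k ≤ p - 1)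
    (h : ∀ A : Matrix (Fin 2) (Fin 2) (ZMod p), A.det = 1 → ∀ f : P p, f.IsHomogeneous k →
      φ (subst A f) = φ f) : ∀ a b, a + b = k → φ (x p ^ a * y p ^ b) = 0 := by
  have h2 := two_le_p (p := p)
  have key : ∀ b, b < k → φ (x p ^ (k - b) * y p ^ b) = 0 := by
    intro b
    induction b using Nat.strong_induction_on with
    | _ b ih =>
      intro hb
      -- Apply y ↦ x + y to the next monomial. By induction the only new term that survives is (b +
      -- 1) x^(k-b) y^b, and b + 1 ≤ k < p is invertible.
      have h1 := h !![1, 1; 0, 1] (by simp [Matrix.det_fin_two])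
        (x p ^ (k - (b + 1)) * y p ^ (b + 1)) (isHomogeneous_monomial_xy' (by omega))
      rw [map_mul, map_pow, map_pow, subst_x, subst_y] at h1
      have e : φ ((C (!![1, 1; 0, 1] 0 0) * x p + C (!![1, 1; 0, 1] 1 0) * y p) ^ (k - (b + 1)) *
          (C (!![1, 1; 0, 1] 0 1) * x p + C (!![1, 1; 0, 1] 1 1) * y p) ^ (b + 1)) =
          φ (x p ^ (k - (b + 1)) * (x p + y p) ^ (b + 1)) := by
        simp
      rw [e, map_mul_add_pow, Finset.sum_range_succ, Finset.sum_range_succ,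
        Finset.sum_eq_zero] at h1
      · have e1 : k - (b + 1) + (b + 1 - b) = k - b := by omega
        rw [Nat.choose_self, Nat.sub_self, add_zero, Nat.cast_one, one_smul, zero_add,
          add_eq_right, e1, Nat.choose_succ_self_right] at h1
        refine (smul_eq_zero.1 h1).resolve_left fun h => ?_
        have := Nat.le_of_dvd (by omega) ((ZMod.natCast_eq_zero_iff _ _).1 h)
        omega
      · intro m hm
        have := Finset.mem_range.1 hm
        have e1 : k - (b + 1) + (b + 1 - m) = k - m := by omega
        rw [e1, ih m this (by omega), smul_zero]
  intro a b hab
  rcases Nat.eq_zero_or_pos a with rfl | ha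
  -- The remaining monomial y^k is the change of x y^(k-1) under x ↦ x + y.
  · have h1 := h !![1, 0; 1, 1] (by simp [Matrix.det_fin_two])
        (x p ^ 1 * y p ^ (k - 1)) (isHomogeneous_monomial_xy' (by omega))
    rw [map_mul, map_pow, map_pow, subst_x, subst_y] at h1
    have e : φ ((C (!![1, 0; 1, 1] 0 0) * x p + C (!![1, 0; 1, 1] 1 0) * y p) ^ 1 *
          (C (!![1, 0; 1, 1] 0 1) * x p + C (!![1, 0; 1, 1] 1 1) * y p) ^ (k - 1)) =
          φ (x p ^ 1 * y p ^ (k - 1)) + φ (x p ^ 0 * y p ^ b) := by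
      rw [← map_add]
      congr 1
      obtain ⟨l, rfl⟩ : ∃ l, k = l + 1 := ⟨k - 1, by omega⟩
      obtain rfl : b = l + 1 := by omega
      simp
      ring
    rw [e] at h1
    simpa using h1
  · have := key b (by omega)
    rwa [show k - b = a by omega] at this

/-- If f is invariant and degree n + k carries the trivial action, then h ↦ f h is an invariant map
on forms of degree k: f · Ah ≡ Af · Ah = A(f h) ≡ f h. -/
theorem mul_subst_sub_mem {s n k : ℕ} {f : P p} (hf : f.IsHomogeneous n)
    (hinv : ∀ A : Matrix (Fin 2) (Fin 2) (ZMod p), A.det = 1 → subst A f - f ∈ dicksonIdeal p s)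
    (htop : ∀ A : Matrix (Fin 2) (Fin 2) (ZMod p), A.det = 1 → ∀ F : P p,
      F.IsHomogeneous (n + k) → subst A F - F ∈ dicksonIdeal p s)
    {A : Matrix (Fin 2) (Fin 2) (ZMod p)} (hA : A.det = 1) {h : P p} (hh : h.IsHomogeneous k) :
    f * subst A h - f * h ∈ dicksonIdeal p s := by
  have := sub_mem (htop A hA _ (hf.mul hh)) (Ideal.mul_mem_right (subst A h) _ (hinv A hA))
  rw [map_mul] at this
  convert this using 1
  ring

/-- Euler's formula on the projective line, for forms fixed by a transvection modulo the square
of the Euler class. -/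
theorem natCast_mul_eval_eq_zero {f : P p} {n : ℕ} (hf : f.IsHomogeneous n)
    (h : eulerForm p ^ 2 ∣ subst !![1, 0; 1, 1] f - f) : (n : ZMod p) * eval ![1, 0] f = 0 := by
  let D := DualNumber (ZMod p)
  -- Evaluation at the tangent vector (1, ε), where E² vanishes. The transvection moves this point
  -- to (1 + ε, ε) = (1 + ε)(1, ε), so homogeneity gives (1 + ε)^n ψ(f) = ψ(f); the claim is the
  -- coefficient of ε.
  let ψ : P p →ₐ[ZMod p] D := aeval ![1, DualNumber.eps]
  have hL : ψ (eulerForm p ^ 2) = 0 := by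
    have e : ψ (eulerForm p) = DualNumber.eps * (1 - DualNumber.eps ^ (p - 1)) := by
      simp only [ψ, eulerForm, map_sub, map_mul, map_pow, aeval_X, Matrix.cons_val_zero,
        Matrix.cons_val_one, one_pow, one_mul, mul_sub, mul_one, ← pow_succ']
      rw [Nat.sub_add_cancel (by have := two_le_p (p := p); omega)]
    rw [map_pow, e, mul_pow, sq DualNumber.eps, DualNumber.eps_mul_eps, zero_mul]
  have h1 : ψ (subst !![1, 0; 1, 1] f) = ψ f := by
    obtain ⟨g, hg⟩ := h
    rw [← sub_eq_zero, ← map_sub, hg, map_mul, hL, zero_mul]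
  have h3 : ψ (subst !![1, 0; 1, 1] f) =
      aeval ![(1 + DualNumber.eps) * 1, (1 + DualNumber.eps) * (DualNumber.eps : D)] f := by
    have : ψ.comp (subst !![1, 0; 1, 1]) = (aeval ![(1 + DualNumber.eps) * 1,
        (1 + DualNumber.eps) * (DualNumber.eps : D)] : P p →ₐ[ZMod p] D) := by
      refine algHom_ext fun j => ?_
      rw [AlgHom.comp_apply, subst_X]
      fin_cases j
      · simp [ψ]
      · simp [ψ, add_mul]
    rw [← this]; rfl
  rw [h3, IsHomogeneous.aeval_mul hf] at h1
  have h4 := congr_arg TrivSqZeroExt.snd h1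
  have h5 : TrivSqZeroExt.fst (ψ f) = eval ![1, 0] f := by
    have : (TrivSqZeroExt.fstHom (ZMod p) (ZMod p) (ZMod p)).comp ψ = aeval ![1, 0] := by
      refine algHom_ext fun j => ?_
      fin_cases j <;> simp [ψ]
    have := DFunLike.congr_fun this f
    simpa [aeval_eq_eval] using this
  change TrivSqZeroExt.snd ((1 + DualNumber.eps) ^ n * ψ f) = _ at h4
  have e0 : TrivSqZeroExt.fst (1 + DualNumber.eps : D) = 1 := by
    rw [TrivSqZeroExt.fst_add, DualNumber.fst_eps, TrivSqZeroExt.fst_one, add_zero]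
  have e1 : TrivSqZeroExt.snd (1 + DualNumber.eps : D) = 1 := by
    rw [TrivSqZeroExt.snd_add, DualNumber.snd_eps, TrivSqZeroExt.snd_one, zero_add]
  rw [TrivSqZeroExt.snd_mul, TrivSqZeroExt.snd_pow, TrivSqZeroExt.fst_pow, h5, e0, e1] at h4
  simpa using h4

theorem isHomogeneous_gam {i : ℕ} (hi : 1 ≤ i) : (gam p i).IsHomogeneous (i * (p - 1)) := by
  refine ((isHomogeneous_X_pow _ _).sub (isHomogeneous_monomial_xy' ?_)).add
    (isHomogeneous_X_pow _ _)
  obtain ⟨k, rfl⟩ : ∃ k, i = k + 1 := ⟨i - 1, by omega⟩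
  simp; ring

/-- The bound matters: for i = 1 the polynomial is y^(p-1), which vanishes at (1, 0). -/
theorem eval_gam_one_zero {i : ℕ} (hi : 2 ≤ i) : eval ![1, 0] (gam p i) = 1 := by
  have h2 := two_le_p (p := p)
  have h1 : (i - 1) * (p - 1) ≠ 0 := Nat.mul_ne_zero (by omega) (by omega)
  have h3 : i * (p - 1) ≠ 0 := Nat.mul_ne_zero (by omega) (by omega)
  simp only [gam, map_add, map_sub, map_mul, map_pow, eval_X, Matrix.cons_val_zero,
    Matrix.cons_val_one, zero_pow h1, zero_pow h3]
  simp

theorem eval_gam_one {i : ℕ} (hi : 2 ≤ i) (t : ZMod p) : eval ![t, 1] (gam p i) = 1 := by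
  have h2 := two_le_p (p := p)
  have h1 : p - 1 ≠ 0 := by omega
  by_cases ht : t = 0
  · have h3 : i * (p - 1) ≠ 0 := Nat.mul_ne_zero (by omega) (by omega)
    simp only [gam, map_add, map_sub, map_mul, map_pow, eval_X, Matrix.cons_val_zero,
      Matrix.cons_val_one, ht, zero_pow h1, zero_pow h3]
    simp
  · simp [gam, mul_comm i, pow_mul, ZMod.pow_card_sub_one_eq_one ht]

theorem subst_gam_sub_mem {i : ℕ} (hi : 2 ≤ i) {A : Matrix (Fin 2) (Fin 2) (ZMod p)}
    (hA : A.det ≠ 0) : subst A (gam p i) - gam p i ∈ dicksonIdeal p 1 := by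
  have hg := isHomogeneous_gam (p := p) (show 1 ≤ i by omega)
  have hone {v : Fin 2 → ZMod p} (hv : v ≠ 0) : eval v (gam p i) = 1 :=
    eval_eq_of_forall hg (eval_gam_one_zero hi) (eval_gam_one hi) hv
  have hinj : Function.Injective fun v : Fin 2 → ZMod p => Matrix.vecMul v A :=
    Matrix.vecMul_injective_of_isUnit ((Matrix.isUnit_iff_isUnit_det A).2 hA.isUnit)
  have hz {v : Fin 2 → ZMod p} (hv : v ≠ 0) : eval v (subst A (gam p i) - gam p i) = 0 := by
    rw [map_sub, eval_subst, hone hv, hone, sub_self]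
    intro h
    exact hv (hinj (h.trans (Matrix.zero_vecMul A).symm))
  refine mem_dicksonIdeal_one_of_dvd (eulerForm_dvd ((isHomogeneous_subst hg A).sub hg)
    (hz fun h => ?_) fun t => hz fun h => ?_)
  · simpa using congr_fun h 0
  · simpa using congr_fun h 1

/-! ### Classification of the SL_2-invariants modulo (E, d). -/

/-- The values of an invariant form are constant on nonzero vectors. -/
theorem eval_eq_of_invariant {f : P p}
    (h : ∀ A : Matrix (Fin 2) (Fin 2) (ZMod p), A.det = 1 → eulerForm p ∣ subst A f - f)
    (t : ZMod p) : eval ![t, 1] f = eval ![1, 0] f := by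
  obtain ⟨g, hg⟩ := h !![t, 1; -1, 0] (by simp [Matrix.det_fin_two])
  have h1 := congr_arg (eval ![1, 0]) hg
  rw [map_sub, map_mul, eval_eulerForm, zero_mul, eval_subst, sub_eq_zero] at h1
  rw [← h1]
  congr 2
  ext j; fin_cases j <;> simp

/-- The matrix diag(u, u⁻¹) scales (1, 0) by u, so a nonzero value there gives u^n = 1 for every
unit u. -/
theorem pred_dvd_of_invariant {f : P p} {n : ℕ} (hf : f.IsHomogeneous n)
    (h : ∀ A : Matrix (Fin 2) (Fin 2) (ZMod p), A.det = 1 → eulerForm p ∣ subst A f - f)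
    (h0 : eval ![1, 0] f ≠ 0) : p - 1 ∣ n := by
  have := FiniteField.forall_pow_eq_one_iff (ZMod p) n
  rw [ZMod.card] at this
  refine this.1 fun u => ?_
  obtain ⟨w, hw⟩ : ∃ w, (u : ZMod p) * w = 1 := ⟨_, u.mul_inv⟩
  obtain ⟨g, hg⟩ := h !![(u : ZMod p), 0; 0, w] (by simp [Matrix.det_fin_two, hw])
  have h1 := congr_arg (eval ![1, 0]) hg
  rw [map_sub, map_mul, eval_eulerForm, zero_mul, eval_subst, sub_eq_zero] at h1
  have e : Matrix.vecMul ![1, 0] !![(u : ZMod p), 0; 0, w] =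
      ![(u : ZMod p) * 1, (u : ZMod p) * 0] := by
    ext j; fin_cases j <;> simp
  rw [e, IsHomogeneous.eval_mul hf] at h1
  ext
  rw [Units.val_pow_eq_pow_val, Units.val_one]
  exact mul_right_cancel₀ h0 (by rw [h1, one_mul])

theorem eulerForm_dvd_of_invariant {f : P p} {n : ℕ} (hf : f.IsHomogeneous n)
    (h : ∀ A : Matrix (Fin 2) (Fin 2) (ZMod p), A.det = 1 → eulerForm p ∣ subst A f - f)
    (h0 : eval ![1, 0] f = 0) : eulerForm p ∣ f :=
  eulerForm_dvd hf h0 fun t => (eval_eq_of_invariant h t).trans h0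

/-- Homogeneous `SL₂`-invariants modulo the Euler class and the Dickson invariant. -/
theorem classification {f : P p} {n : ℕ} (hf : f.IsHomogeneous n)
    (h : ∀ A : Matrix (Fin 2) (Fin 2) (ZMod p), A.det = 1 → subst A f - f ∈ dicksonIdeal p 1) :
    n = 0 ∨ f ∈ dicksonIdeal p 1 ∨
      (∃ i c, 2 ≤ i ∧ i ≤ p - 1 ∧ n = i * (p - 1) ∧ f - C c * gam p i ∈ dicksonIdeal p 1) ∨
      (n = p ^ 2 - 1 ∧ ∃ c, f - C c * mu p ∈ dicksonIdeal p 1) := by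
  have h2 := two_le_p (p := p)
  have htop := top_degree_eq (p := p)
  have hsq := mul_pred_add (p := p)
  rcases Nat.eq_zero_or_pos n with hn0 | hn0
  · exact Or.inl hn0
  refine Or.inr ?_
  rcases lt_or_ge n (p * (p - 1)) with hn | hn
  · have hL : ∀ A : Matrix (Fin 2) (Fin 2) (ZMod p), A.det = 1 → eulerForm p ∣ subst A f - f :=
      fun A hA => by
        simpa using eulerForm_pow_dvd_of_mem ((isHomogeneous_subst hf A).sub hf) hn (h A hA)
    have h1 := eval_eq_of_invariant hL
    by_cases h0 : eval ![1, 0] f = 0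
    · exact Or.inl (mem_dicksonIdeal_one_of_dvd (eulerForm_dvd_of_invariant hf hL h0))
    obtain ⟨i, rfl⟩ := pred_dvd_of_invariant hf hL h0
    rw [mul_comm] at hf hn hn0
    have hip : i < p := Nat.lt_of_mul_lt_mul_right hn
    have hi0 : 0 < i := Nat.pos_of_mul_pos_right hn0
    by_cases hi : i = 1
    -- In degree p - 1 the sum of all values is zero, whereas a form with value c off the origin has
    -- sum (p^2 - 1) c = -c.
    · exfalso
      subst hi
      have hs := evalSum_eq_zero_of_pred (p := p) (by simpa using hf)
      rw [evalSum_apply] at hs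
      have : ∀ v : Fin 2 → ZMod p, eval v f =
          eval ![1, 0] f - if v = 0 then eval ![1, 0] f else 0 := by
        intro v
        split_ifs with hv
        · rw [hv, IsHomogeneous.eval_zero hf hn0.ne', sub_self]
        · rw [sub_zero, eval_eq_of_forall hf rfl h1 hv]
      rw [Finset.sum_congr rfl fun v _ => this v, Finset.sum_sub_distrib] at hs
      simp at hs
      exact h0 hs
    · refine Or.inr (Or.inl ⟨i, eval ![1, 0] f, by omega, by omega, mul_comm _ _, ?_⟩)
      refine mem_dicksonIdeal_one_of_dvd
        (eulerForm_dvd (hf.sub ((isHomogeneous_gam hi0).C_mul _)) ?_ fun t => ?_)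
      · simp [eval_gam_one_zero (show 2 ≤ i by omega)]
      · simp [eval_gam_one (show 2 ≤ i by omega), h1]
  · rcases le_or_gt (p ^ 2) n with hn' | hn'
    · exact Or.inl (mem_dicksonIdeal_one_of_sq_le hf hn')
    by_cases hn1 : n = p ^ 2 - 1
    · subst hn1
      exact Or.inr (Or.inr ⟨rfl, exists_sub_mu_mem hf⟩)
    · refine Or.inl ?_
      obtain ⟨m, hm⟩ : ∃ m, n = m + p * (p - 1) := ⟨n - p * (p - 1), by omega⟩
      obtain ⟨k, hk⟩ : ∃ k, k + m = p - 1 := ⟨p - 1 - m, by omega⟩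
      refine mem_dicksonIdeal_of_evalSum_mul hf hm hk (by omega) ?_
      refine eq_zero_of_map_subst_eq (evalSum ∘ₗ LinearMap.mulLeft (ZMod p) f) (k := k) (by omega)
        (by omega) fun A hA g hg => ?_
      have hnk : n + k = p ^ 2 - 1 := by omega
      have hA0 : A.det ≠ 0 := by rw [hA]; exact one_ne_zero
      have h3 := mul_subst_sub_mem hf h (k := k) (fun B hB F hF =>
        subst_sub_mem_of_top (by rw [hB]; exact one_ne_zero) (hnk ▸ hF)) hA hg
      have h4 := evalSum_eq_zero_of_mem
        (hnk ▸ (hf.mul (isHomogeneous_subst hg A)).sub (hf.mul hg)) h3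
      rw [map_sub, sub_eq_zero] at h4
      simpa using h4

/-- Homogeneous `SL₂`-invariants modulo the Euler class and the Dickson invariant are invariant
under the general linear group. -/
theorem subst_sub_mem_of_special {f : P p} {n : ℕ} (hf : f.IsHomogeneous n)
    (h : ∀ A : Matrix (Fin 2) (Fin 2) (ZMod p), A.det = 1 → subst A f - f ∈ dicksonIdeal p 1)
    {A : Matrix (Fin 2) (Fin 2) (ZMod p)} (hA : A.det ≠ 0) :
    subst A f - f ∈ dicksonIdeal p 1 := by
  have key {c : ZMod p} {w : P p} (hw : subst A w - w ∈ dicksonIdeal p 1)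
      (hfw : f - C c * w ∈ dicksonIdeal p 1) : subst A f - f ∈ dicksonIdeal p 1 := by
    have := sub_mem (add_mem (subst_mem hA hfw) (Ideal.mul_mem_left _ (C c) hw)) hfw
    rw [map_sub, map_mul, subst_C] at this
    convert this using 1
    ring
  rcases classification hf h with hn | h | ⟨i, c, hi, -, -, h⟩ | ⟨-, c, h⟩
  · subst hn
    rw [totalDegree_eq_zero_iff_eq_C.1 ((totalDegree_zero_iff_isHomogeneous _).2 hf), subst_C, sub_self]
    exact zero_mem _
  · exact sub_mem (subst_mem hA h) h
  · exact key (subst_gam_sub_mem hi hA) h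
  · exact key (subst_sub_mem_of_top hA isHomogeneous_mu) h

/-! ### Invariants of the groups between SL_2 and GL_2. -/

theorem exists_root_of_unity {r s : ℕ} (hr : r ∣ p - 1) (hs : 0 < s) (hsr : s < r) :
    ∃ ζ : ZMod p, ζ ^ r = 1 ∧ ζ ^ s ≠ 1 := by
  by_contra! H
  obtain ⟨e, he⟩ := hr
  have h2 := two_le_p (p := p)
  have h := FiniteField.forall_pow_eq_one_iff (ZMod p) (e * s)
  rw [ZMod.card] at h
  have h1 : p - 1 ∣ e * s := by
    refine h.1 fun u => ?_
    ext
    have := H ((u : ZMod p) ^ e) (by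
      rw [← pow_mul, mul_comm, ← he, ZMod.pow_card_sub_one_eq_one u.ne_zero])
    simpa [pow_mul] using this
  have he0 : 0 < e := Nat.pos_of_ne_zero (by rintro rfl; omega)
  rw [he, mul_comm r, Nat.mul_dvd_mul_iff_left he0] at h1
  exact absurd (Nat.le_of_dvd hs h1) (by omega)

theorem exists_quotient_eulerForm {f : P p} {n : ℕ} (hf : f.IsHomogeneous n)
    (h : eulerForm p ∣ f) : ∃ g m, g.IsHomogeneous m ∧ f = g * eulerForm p := by
  obtain ⟨g, hg⟩ := h
  obtain ⟨u, m, hu, hu', -⟩ := exists_homogeneousComponent_mul g isHomogeneous_eulerForm n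
  refine ⟨u, m, hu, ?_⟩
  rw [← hu', mul_comm, ← hg, homogeneousComponent_eq_self hf]

/-- Invariants of positive degree of a group between `SL₂` and `GL₂`. -/
theorem exists_of_invariant {f : P p} {n r : ℕ} (hr : r ∣ p - 1) (hf : f.IsHomogeneous n)
    (hn : 0 < n)
    (h : ∀ A : Matrix (Fin 2) (Fin 2) (ZMod p), A.det ^ r = 1 → subst A f = f) {s : ℕ}
    (hs : 1 ≤ s) (hsr : s ≤ r) : ∃ c j, 0 < j ∧ ∃ g m, g.IsHomogeneous m ∧
      f = g * eulerForm p ^ s + C c * dickson p ^ j := by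
  have h2 := two_le_p (p := p)
  induction s, hs using Nat.le_induction with
  | base =>
    have hL : ∀ A : Matrix (Fin 2) (Fin 2) (ZMod p), A.det = 1 → eulerForm p ∣ subst A f - f :=
      fun A hA => by rw [h A (by rw [hA, one_pow]), sub_self]; exact dvd_zero _
    by_cases h0 : eval ![1, 0] f = 0
    · obtain ⟨g, m, hg, hfg⟩ :=
        exists_quotient_eulerForm hf (eulerForm_dvd_of_invariant hf hL h0)
      exact ⟨0, 1, one_pos, g, m, hg, by rw [hfg]; simp⟩
    · have hd := pred_dvd_of_invariant hf hL h0
      -- Euler's formula gives p ∣ n; with p - 1 ∣ n this makes n a multiple of the degree of d, so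
      -- a power of d can absorb the nonzero value.
      have hp : p ∣ n := by
        have := natCast_mul_eval_eq_zero hf (by
          rw [h _ (by simp [Matrix.det_fin_two]), sub_self]; exact dvd_zero _)
        exact (ZMod.natCast_eq_zero_iff _ _).1 ((mul_eq_zero.1 this).resolve_right h0)
      have hcop : Nat.Coprime p (p - 1) := by
        rw [(Fact.out : p.Prime).coprime_iff_not_dvd]
        intro h
        have := Nat.le_of_dvd (by omega) h
        omega
      obtain ⟨j, hj⟩ := hcop.mul_dvd_of_dvd_of_dvd hp hd
      have hhom : (f - C (eval ![1, 0] f) * dickson p ^ j).IsHomogeneous n := by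
        refine hf.sub (IsHomogeneous.C_mul ?_ _)
        rw [hj]
        exact isHomogeneous_dickson.pow j
      obtain ⟨g, m, hg, hfg⟩ := exists_quotient_eulerForm hhom (eulerForm_dvd hhom
        (by simp [eval_dickson_one_zero])
        (fun t => by simp [eval_dickson_one, eval_eq_of_invariant hL]))
      refine ⟨eval ![1, 0] f, j, Nat.pos_of_ne_zero ?_, g, m, hg, ?_⟩
      · rintro rfl
        omega
      · rw [pow_one, ← hfg]; ring
  | succ s hs ih =>
    obtain ⟨c, j, hj, g, m, hg, hfg⟩ := ih (by omega)
    have hsemi : ∀ A : Matrix (Fin 2) (Fin 2) (ZMod p), A.det ^ r = 1 →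
        C (A.det ^ s) * subst A g = g := by
      intro A hA
      have hA0 : A.det ≠ 0 := by
        intro h0
        rw [h0, zero_pow (by omega)] at hA
        exact zero_ne_one hA
      have h1 := h A hA
      rw [hfg, map_add, map_mul, map_mul, map_pow, map_pow, subst_eulerForm, subst_dickson hA0,
        subst_C, add_left_inj, mul_pow, ← C_pow] at h1
      refine mul_right_cancel₀ (pow_ne_zero s eulerForm_ne_zero) ?_
      rw [← h1]; ring
    obtain ⟨ζ, hζ, hζ'⟩ := exists_root_of_unity hr hs (show s < r by omega)
    -- The matrix diag(1, ζ) fixes the point (1, 0) but has determinant ζ, so semi-invariance gives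
    -- ζ^s g(1, 0) = g(1, 0) with ζ^s ≠ 1.
    have h0 : eval ![1, 0] g = 0 := by
      have h1 := congr_arg (eval ![1, 0]) (hsemi !![1, 0; 0, ζ] (by simp [Matrix.det_fin_two, hζ]))
      rw [map_mul, eval_C, eval_subst] at h1
      have e : Matrix.vecMul ![1, 0] !![1, 0; 0, ζ] = ![1, 0] := by
        ext j; fin_cases j <;> simp
      have e' : (!![1, 0; 0, ζ] : Matrix (Fin 2) (Fin 2) (ZMod p)).det = ζ := by
        simp [Matrix.det_fin_two]
      rw [e, e'] at h1
      by_contra h0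
      exact hζ' (mul_right_cancel₀ h0 (by rw [h1, one_mul]))
    obtain ⟨u, k, hu, hgu⟩ := exists_quotient_eulerForm hg (eulerForm_dvd_of_invariant hg
      (fun A hA => by
        have := hsemi A (by rw [hA, one_pow])
        rw [hA, one_pow, C_1, one_mul] at this
        rw [this, sub_self]
        exact dvd_zero _) h0)
    refine ⟨c, j, hj, u, k, hu, ?_⟩
    rw [hfg, hgu]; ring

/-! ### Vanishing of the invariants for r > 1. -/

/-- The Euler class lies in the augmentation span of the forms of degree `p + 1`. -/
theorem map_eulerForm_eq_zero {M : Type*} [AddCommGroup M] [Module (ZMod p) M]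
    (φ : P p →ₗ[ZMod p] M) (hp : 3 ≤ p)
    (h : ∀ A : Matrix (Fin 2) (Fin 2) (ZMod p), A.det = 1 → ∀ f : P p, f.IsHomogeneous (p + 1) →
      φ (subst A f) = φ f) : φ (eulerForm p) = 0 := by
  have hu (f : P p) (hf : f.IsHomogeneous (p + 1)) :
      φ (subst !![1, 1; 0, 1] f - f) = 0 := by
    rw [map_sub, h _ (by simp [Matrix.det_fin_two]) f hf, sub_self]
  have hx : subst !![1, 1; 0, 1] (x p) = x p := by rw [subst_x]; simp
  have hy : subst !![1, 1; 0, 1] (y p) = x p + y p := by rw [subst_y]; simp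
  -- The changes of these three monomials under y ↦ x + y are x^(p+1), x^(p+1) + 2 x^p y and x^(p+1)
  -- + x^p y + x y^p. As 2 is invertible, φ kills x^p y and x y^p separately.
  have h1 := hu (x p ^ p * y p ^ 1) (isHomogeneous_monomial_xy' (by omega))
  have h2 := hu (x p ^ (p - 1) * y p ^ 2) (isHomogeneous_monomial_xy' (by omega))
  have h3 := hu (x p ^ 0 * y p ^ (p + 1)) (isHomogeneous_monomial_xy' (by omega))
  simp only [map_mul, map_pow, hx, hy] at h1 h2 h3
  have e1 : x p ^ p * (x p + y p) ^ 1 - x p ^ p * y p ^ 1 = x p ^ (p + 1) := by ring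
  have e2 : x p ^ (p - 1) * (x p + y p) ^ 2 - x p ^ (p - 1) * y p ^ 2 =
      x p ^ (p + 1) + (2 : ZMod p) • (x p ^ p * y p) := by
    rw [smul_eq_C_mul, map_ofNat]
    obtain ⟨k, hk⟩ : ∃ k, p = k + 1 := ⟨p - 1, by omega⟩
    have e : x p ^ p = x p ^ (p - 1) * x p := by
      rw [← pow_succ]; congr 1; omega
    rw [pow_succ _ p, e]; ring
  have e3 : x p ^ 0 * (x p + y p) ^ (p + 1) - x p ^ 0 * y p ^ (p + 1) =
      x p ^ (p + 1) + x p ^ p * y p + x p * y p ^ p := by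
    rw [pow_succ (x p + y p), add_pow_char]; ring
  rw [e1] at h1
  rw [e2, map_add, h1, zero_add, map_smul] at h2
  have h20 : (2 : ZMod p) ≠ 0 := by
    intro h
    have : ((2 : ℕ) : ZMod p) = 0 := by exact_mod_cast h
    have := Nat.le_of_dvd (by omega) ((ZMod.natCast_eq_zero_iff _ _).1 this)
    omega
  have h2 := (smul_eq_zero.1 h2).resolve_left h20
  rw [e3, map_add, map_add, h1, h2, zero_add, zero_add] at h3
  rw [eulerForm, map_sub, h2, h3, sub_zero]

/-- Forms of degree `p ^ 2 + p` are `SL₂`-invariant modulo the square of the Euler class. -/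
theorem subst_sub_mem_of_top_two {A : Matrix (Fin 2) (Fin 2) (ZMod p)} (hA : A.det = 1) {f : P p}
    (hf : f.IsHomogeneous (p ^ 2 - 1 + (p + 1))) : subst A f - f ∈ dicksonIdeal p 2 := by
  have h2 := two_le_p (p := p)
  have hA0 : A.det ≠ 0 := by rw [hA]; exact one_ne_zero
  obtain ⟨a, b, hab⟩ := mem_dicksonIdeal.1 (mem_dicksonIdeal_one_of_sq_le hf (by omega))
  rw [pow_one] at hab
  obtain ⟨u, m, hu, hu', hm, -⟩ := exists_homogeneousComponent_mul a
    (isHomogeneous_eulerForm (p := p)) (p ^ 2 - 1 + (p + 1))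
  obtain ⟨v, j, hv, hv', -⟩ := exists_homogeneousComponent_mul b
    (isHomogeneous_dickson (p := p)) (p ^ 2 - 1 + (p + 1))
  obtain rfl : m = p ^ 2 - 1 := by have := hm (by omega); omega
  have hfu : f = u * eulerForm p + v * dickson p := by
    rw [← hu', ← hv', ← map_add, hab, homogeneousComponent_eq_self hf]
  -- The cofactor u of E has degree p^2 - 1, where the action is trivial modulo (E, d); multiplying
  -- by the SL_2-invariant E lifts this to (E^2, d).
  obtain ⟨c, d, hcd⟩ := mem_dicksonIdeal.1 (subst_sub_mem_of_top hA0 hu)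
  refine mem_dicksonIdeal.2 ⟨c, d * eulerForm p + subst A v - v, ?_⟩
  rw [hfu, map_add, map_mul, map_mul, subst_eulerForm, subst_dickson hA0, hA, C_1]
  linear_combination eulerForm p * hcd

/-- For `r > 1` an invariant class reduces to zero modulo the Euler class. -/
theorem mem_dicksonIdeal_one_of_invariant {f : P p} {n r : ℕ} (hp : 3 ≤ p) (hr : 2 ≤ r)
    (hf : f.IsHomogeneous n) (hn : 0 < n)
    (h : ∀ A : Matrix (Fin 2) (Fin 2) (ZMod p), A.det ^ r = 1 → subst A f - f ∈ dicksonIdeal p r) :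
    f ∈ dicksonIdeal p 1 := by
  have h2 : ∀ A : Matrix (Fin 2) (Fin 2) (ZMod p), A.det = 1 → subst A f - f ∈ dicksonIdeal p 2 :=
    fun A hA => dicksonIdeal_anti hr (h A (by rw [hA, one_pow]))
  have h1 := fun A hA => dicksonIdeal_anti (show 1 ≤ 2 by omega) (h2 A hA)
  rcases classification hf h1 with hn | h | ⟨i, c, hi, hip, hn, hc⟩ | ⟨hn, c, hc⟩
  · omega
  · exact h
  · have hlt : n < p * (p - 1) := by
      rw [hn]; exact Nat.mul_lt_mul_of_pos_right (by omega) (by omega)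
    have h0 := natCast_mul_eval_eq_zero hf (eulerForm_pow_dvd_of_mem
      ((isHomogeneous_subst hf _).sub hf) hlt (h2 _ (by simp [Matrix.det_fin_two])))
    -- Neither factor of n = i(p - 1) is divisible by p.
    have h0 : eval ![1, 0] f = 0 := by
      refine (mul_eq_zero.1 h0).resolve_left fun h => ?_
      rw [ZMod.natCast_eq_zero_iff, hn, (Fact.out : p.Prime).dvd_mul] at h
      rcases h with h | h
      · have := Nat.le_of_dvd (by omega) h; omega
      · have := Nat.le_of_dvd (by omega) h; omega
    have hL : ∀ A : Matrix (Fin 2) (Fin 2) (ZMod p), A.det = 1 → eulerForm p ∣ subst A f - f :=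
      fun A hA => by
        simpa using eulerForm_pow_dvd_of_mem ((isHomogeneous_subst hf A).sub hf) hlt (h1 A hA)
    exact mem_dicksonIdeal_one_of_dvd (eulerForm_dvd_of_invariant hf hL h0)
  · subst hn
    -- Multiplication by f, read modulo (E^2, d), is an invariant map on forms of degree p + 1, so
    -- it kills E; a factor E can then be cancelled.
    have hzero : f * eulerForm p ∈ dicksonIdeal p 2 := by
      rw [← Ideal.Quotient.eq_zero_iff_mem]
      refine map_eulerForm_eq_zero ((Ideal.Quotient.mkₐ (ZMod p) (dicksonIdeal p 2)).toLinearMap ∘ₗ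
        LinearMap.mulLeft (ZMod p) f) hp fun A hA g hg => ?_
      have := mul_subst_sub_mem hf h2 (fun B hB F hF => subst_sub_mem_of_top_two hB hF) hA hg
      exact Ideal.Quotient.eq.2 this
    exact mem_of_mul_eulerForm_pow_mem (j := 1) (by simpa using hzero)

theorem mem_dicksonIdeal_of_invariant {f : P p} {n r : ℕ} (hr : r ∣ p - 1) (hr2 : 2 ≤ r)
    (hf : f.IsHomogeneous n) (hn : 0 < n)
    (h : ∀ A : Matrix (Fin 2) (Fin 2) (ZMod p), A.det ^ r = 1 → subst A f - f ∈ dicksonIdeal p r) :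
    f ∈ dicksonIdeal p r := by
  have h2 := two_le_p (p := p)
  have hp : 3 ≤ p := by
    have := Nat.le_of_dvd (by omega) hr
    omega
  suffices ∀ s, 1 ≤ s → s ≤ r → ∃ g m b, g.IsHomogeneous m ∧
      f = g * eulerForm p ^ s + b * dickson p by
    obtain ⟨g, m, b, -, hg⟩ := this r (by omega) le_rfl
    exact mem_dicksonIdeal.2 ⟨g, b, hg.symm⟩
  intro s hs
  induction s, hs using Nat.le_induction with
  | base =>
    intro _
    obtain ⟨u, v, i, j, hu, -, hf', -⟩ :=
      exists_isHomogeneous_of_mem hf (mem_dicksonIdeal_one_of_invariant hp hr2 hf hn h)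
    exact ⟨u, i, v, hu, hf'⟩
  | succ s hs ih =>
    intro hsr
    obtain ⟨g, m, b, hg, hfg⟩ := ih (by omega)
    have hsemi : ∀ A : Matrix (Fin 2) (Fin 2) (ZMod p), A.det ^ r = 1 → A.det ≠ 0 →
        C (A.det ^ s) * subst A g - g ∈ dicksonIdeal p 1 := by
      intro A hA hA0
      refine mem_of_mul_eulerForm_pow_mem (j := s) ?_
      have h1 := dicksonIdeal_anti hsr (h A hA)
      rw [hfg, map_add, map_mul, map_mul, map_pow, subst_eulerForm, subst_dickson hA0,
        mul_pow, ← C_pow] at h1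
      have := sub_mem h1 (Ideal.mul_mem_left _ (subst A b - b) (dickson_mem (p := p) (s + 1)))
      convert this using 1
      ring
    have hspec : ∀ A : Matrix (Fin 2) (Fin 2) (ZMod p), A.det = 1 →
        subst A g - g ∈ dicksonIdeal p 1 := fun A hA => by
      have := hsemi A (by rw [hA, one_pow]) (by rw [hA]; exact one_ne_zero)
      rwa [hA, one_pow, C_1, one_mul] at this
    obtain ⟨ζ, hζ, hζ'⟩ := exists_root_of_unity hr hs (show s < r by omega)
    have hζ0 : ζ ≠ 0 := by
      rintro rfl
      rw [zero_pow (by omega)] at hζ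
      exact zero_ne_one hζ
    have e : (!![1, 0; 0, ζ] : Matrix (Fin 2) (Fin 2) (ZMod p)).det = ζ := by
      simp [Matrix.det_fin_two]
    have h1 := hsemi !![1, 0; 0, ζ] (by rw [e, hζ]) (by rwa [e])
    have h3 := subst_sub_mem_of_special hg hspec (A := !![1, 0; 0, ζ]) (by rwa [e])
    have hgmem : g ∈ dicksonIdeal p 1 := by
      -- The elements ζ^s Ag - g and ζ^s (Ag - g) both lie in the ideal; their difference is (ζ^s -
      -- 1) g.
      have := Ideal.mul_mem_left _ (C (ζ ^ s - 1)⁻¹)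
        (sub_mem h1 (Ideal.mul_mem_left _ (C (ζ ^ s)) h3))
      rw [e] at this
      convert this using 1
      have hC : C (ζ ^ s - 1)⁻¹ * (C (ζ ^ s) - 1) = (1 : P p) := by
        rw [← C_1, ← C_sub, ← C_mul, inv_mul_cancel₀ (sub_ne_zero.2 hζ')]
      linear_combination -g * hC
    obtain ⟨u, v, i, j, hu, -, hg', -⟩ := exists_isHomogeneous_of_mem hg hgmem
    refine ⟨u, i, b + v * eulerForm p ^ s, hu, ?_⟩
    rw [hfg, hg']
    ring

/-! ### Passage to the coinvariant algebra. -/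

theorem mem_L {r : ℕ} {g : GL2 p} :
    g ∈ L p r ↔ (g : Matrix (Fin 2) (Fin 2) (ZMod p)).det ^ r = 1 := by
  change Matrix.GeneralLinearGroup.det (g ^ r) = 1 ↔ _
  rw [map_pow, Units.ext_iff, Units.val_pow_eq_pow_val, Units.val_one]
  rfl

theorem forall_mem_L {r : ℕ} (hr : 0 < r) {Q : Matrix (Fin 2) (Fin 2) (ZMod p) → Prop} :
    (∀ g ∈ L p r, Q (g : GL2 p)) ↔ ∀ A : Matrix (Fin 2) (Fin 2) (ZMod p), A.det ^ r = 1 → Q A := by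
  refine ⟨fun h A hA => ?_, fun h g hg => h _ (mem_L.1 hg)⟩
  have hA0 : A.det ≠ 0 := by
    intro h0
    rw [h0, zero_pow hr.ne'] at hA
    exact zero_ne_one hA
  exact h (Matrix.GeneralLinearGroup.mkOfDetNeZero A hA0) (mem_L.2 hA)

theorem J1_L {r : ℕ} (hr : r ∣ p - 1) (hr0 : 0 < r) : J1 (L p r) = dicksonIdeal p r := by
  have h2 := two_le_p (p := p)
  refine le_antisymm (Ideal.span_le.2 ?_) (Ideal.span_le.2 ?_)
  · rintro f ⟨hf, n, hn, hfn⟩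
    have hf' := (forall_mem_L (Q := fun A => subst A f = f) hr0).1 hf
    obtain ⟨c, j, hj, g, m, -, rfl⟩ := exists_of_invariant hr hfn hn hf' hr0 le_rfl
    exact add_mem (Ideal.mul_mem_left _ _ (eulerForm_pow_mem r))
      (Ideal.mul_mem_left _ _ (Ideal.pow_mem_of_mem _ (dickson_mem r) _ hj))
  · rintro f (rfl | rfl)
    · refine Ideal.subset_span ⟨?_, (p + 1) * r, by positivity, isHomogeneous_eulerForm.pow r⟩
      refine (forall_mem_L (Q := fun A => subst A (eulerForm p ^ r) = eulerForm p ^ r) hr0).2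
        fun A hA => ?_
      rw [map_pow, subst_eulerForm, mul_pow, ← C_pow, hA, C_1, one_mul]
    · refine Ideal.subset_span ⟨fun g _ => subst_dickson ?_, p * (p - 1),
        Nat.mul_pos (by omega) (by omega), isHomogeneous_dickson⟩
      exact g.det.ne_zero

theorem homogeneousComponent_subst (A : Matrix (Fin 2) (Fin 2) (ZMod p)) (f : P p) (n : ℕ) :
    homogeneousComponent n (subst A f) = subst A (homogeneousComponent n f) := by
  conv_lhs => rw [← sum_homogeneousComponent f]
  rw [map_sum, map_sum]
  have h (i : ℕ) := homogeneousComponent_of_mem (m := n) ((mem_homogeneousSubmodule _ _).2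
    (isHomogeneous_subst (homogeneousComponent_isHomogeneous i f) A))
  rw [Finset.sum_congr rfl fun i _ => h i, Finset.sum_ite_eq]
  split_ifs with hn
  · rfl
  · rw [homogeneousComponent_eq_zero, map_zero]
    simpa [Nat.lt_succ_iff] using hn

theorem homogeneousComponent_mem_J1 {G : Subgroup (GL2 p)} {f : P p} (hf : f ∈ J1 G) (n : ℕ) :
    homogeneousComponent n f ∈ J1 G := by
  let := MvPolynomial.gradedAlgebra (R := ZMod p) (σ := Fin 2)
  refine homogeneousComponent_mem_of_mem (Ideal.homogeneous_span _ _ ?_) hf n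
  rintro g ⟨-, m, -, hg⟩
  exact ⟨m, (mem_homogeneousSubmodule _ _).2 hg⟩

theorem proj_eq_zero {G : Subgroup (GL2 p)} {f : P p} : proj G f = 0 ↔ f ∈ J1 G :=
  Ideal.Quotient.eq_zero_iff_mem

theorem proj_mem_invariants {G : Subgroup (GL2 p)} {f : P p} :
    proj G f ∈ (coinvRep G).invariants ↔ ∀ g ∈ G, act g f - f ∈ J1 G := by
  rw [Representation.mem_invariants]
  refine ⟨fun h g hg => ?_, fun h g => ?_⟩
  · rw [← proj_eq_zero, map_sub, sub_eq_zero]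
    exact h ⟨g, hg⟩
  · rw [coinvRep_proj, ← sub_eq_zero, ← map_sub, proj_eq_zero]
    exact h g g.2

theorem proj_mem_positivePart {G : Subgroup (GL2 p)} {f : P p} {n : ℕ} (hf : f.IsHomogeneous n)
    (hn : 0 < n) : proj G f ∈ positivePart G :=
  Submodule.mem_iSup_of_mem n (Submodule.mem_iSup_of_mem hn
    (Submodule.mem_map_of_mem ((mem_homogeneousSubmodule _ _).2 hf)))

/-- The invariants of the positive part are spanned by the homogeneous ones. -/
theorem positiveInvariants_le {G : Subgroup (GL2 p)} {S : Submodule (ZMod p) (Coinv G)}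
    (h : ∀ (f : P p) (n : ℕ), 0 < n → f.IsHomogeneous n → (∀ g ∈ G, act g f - f ∈ J1 G) →
      proj G f ∈ S) : positiveInvariants G ≤ S := by
  rintro a ⟨ha, ha'⟩
  -- This provides a lift without constant term, so only components of positive degree enter the sum
  -- below.
  have hpos : positivePart G ≤ (LinearMap.ker
      (homogeneousComponent (R := ZMod p) (σ := Fin 2) 0)).map (proj G).toLinearMap := by
    refine iSup₂_le fun n hn => Submodule.map_mono fun f hf => ?_
    rw [LinearMap.mem_ker, homogeneousComponent_of_mem hf, if_neg hn.ne]
  obtain ⟨f, hf, rfl⟩ := hpos ha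
  have hinv := proj_mem_invariants.1 ha'
  change proj G f ∈ S
  rw [← sum_homogeneousComponent f, map_sum]
  refine Submodule.sum_mem _ fun n _ => ?_
  rcases Nat.eq_zero_or_pos n with rfl | hn
  · rw [LinearMap.mem_ker.1 hf, map_zero]
    exact zero_mem _
  · refine h _ n hn (homogeneousComponent_isHomogeneous n f) fun g hg => ?_
    have := homogeneousComponent_mem_J1 (hinv g hg) n
    rw [map_sub] at this
    convert this using 2
    exact (homogeneousComponent_subst _ _ _).symm

theorem top_degree_pos : 0 < p ^ 2 - 1 := by
  have := top_degree_eq (p := p)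
  have := two_le_p (p := p)
  omega

theorem dicksonIdeal_eq_J1 : J1 (L p 1) = dicksonIdeal p 1 := J1_L (one_dvd _) one_pos

theorem proj_eq_smul {f w : P p} {c : ZMod p} (h : f - C c * w ∈ dicksonIdeal p 1) :
    proj (L p 1) f = c • proj (L p 1) w := by
  rw [← map_smul, ← sub_eq_zero, ← map_sub, proj_eq_zero, dicksonIdeal_eq_J1, smul_eq_C_mul]
  exact h

theorem isFundamentalClass_mu : IsFundamentalClass (L p 1) (proj (L p 1) (mu p)) := by
  refine ⟨fun h => ?_, p ^ 2 - 1, le_antisymm ?_ ?_, fun n hn => ?_⟩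
  · rw [proj_eq_zero, dicksonIdeal_eq_J1] at h
    exact one_ne_zero (C_mul_mu_mem (c := (1 : ZMod p)) (by rwa [C_1, one_mul]))
  · rintro _ ⟨f, hf, rfl⟩
    obtain ⟨c, hc⟩ := exists_sub_mu_mem ((mem_homogeneousSubmodule _ _).1 hf)
    exact Submodule.mem_span_singleton.2 ⟨c, (proj_eq_smul hc).symm⟩
  · rw [Submodule.span_singleton_le_iff_mem]
    exact Submodule.mem_map_of_mem ((mem_homogeneousSubmodule _ _).2 isHomogeneous_mu)
  · rw [eq_bot_iff]
    rintro _ ⟨f, hf, rfl⟩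
    refine proj_eq_zero.2 ?_
    rw [dicksonIdeal_eq_J1]
    exact mem_dicksonIdeal_one_of_sq_le ((mem_homogeneousSubmodule _ _).1 hf) (by omega)

theorem positiveInvariants_L_one : positiveInvariants (L p 1) = Submodule.span (ZMod p)
    ({proj (L p 1) (mu p)} ∪
      {a | ∃ i : ℕ, 2 ≤ i ∧ i ≤ p - 1 ∧ a = proj (L p 1) (gam p i)}) := by
  have h2 := two_le_p (p := p)
  refine le_antisymm (positiveInvariants_le fun f n hn hf hinv => ?_) (Submodule.span_le.2 ?_)
  · rw [dicksonIdeal_eq_J1] at hinv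
    have hinv := (forall_mem_L (Q := fun A => subst A f - f ∈ dicksonIdeal p 1) one_pos).1 hinv
    rcases classification hf fun A hA => hinv A (by rw [hA, one_pow]) with
      h | h | ⟨i, c, hi, hip, -, h⟩ | ⟨-, c, h⟩
    · omega
    · rw [← dicksonIdeal_eq_J1, ← proj_eq_zero] at h
      rw [h]
      exact zero_mem _
    · rw [proj_eq_smul h]
      exact Submodule.smul_mem _ _ (Submodule.subset_span (Or.inr ⟨i, hi, hip, rfl⟩))
    · rw [proj_eq_smul h]
      exact Submodule.smul_mem _ _ (Submodule.subset_span (Or.inl rfl))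
  · rintro _ (rfl | ⟨i, hi, hip, rfl⟩)
    · refine ⟨proj_mem_positivePart isHomogeneous_mu top_degree_pos,
        proj_mem_invariants.2 fun g _ => ?_⟩
      rw [dicksonIdeal_eq_J1]
      exact subst_sub_mem_of_top g.det.ne_zero isHomogeneous_mu
    · refine ⟨proj_mem_positivePart (isHomogeneous_gam (by omega))
        (Nat.mul_pos (by omega) (by omega)), proj_mem_invariants.2 fun g _ => ?_⟩
      rw [dicksonIdeal_eq_J1]
      exact subst_gam_sub_mem hi g.det.ne_zero

theorem positiveInvariants_L_eq_bot {r : ℕ} (hr : r ∣ p - 1) (hr1 : 1 < r) :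
    positiveInvariants (L p r) = ⊥ := by
  rw [eq_bot_iff]
  refine positiveInvariants_le fun f n hn hf hinv => ?_
  rw [Submodule.mem_bot, proj_eq_zero]
  rw [J1_L hr (by omega)] at hinv ⊢
  exact mem_dicksonIdeal_of_invariant hr hr1 hf hn
    ((forall_mem_L (Q := fun A => subst A f - f ∈ dicksonIdeal p r) (by omega)).1 hinv)

end CoinvGL2

theorem mainTheorem5 (p : ℕ) [Fact p.Prime] (r : ℕ) (hr : r ∣ p - 1) :
    (1 < r → CoinvGL2.positiveInvariants (CoinvGL2.L p r) = ⊥) ∧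
    (r = 1 →
      CoinvGL2.IsFundamentalClass (CoinvGL2.L p r)
        (CoinvGL2.proj (CoinvGL2.L p r) (CoinvGL2.mu p)) ∧
      CoinvGL2.positiveInvariants (CoinvGL2.L p r) =
        Submodule.span (ZMod p)
          ({CoinvGL2.proj (CoinvGL2.L p r) (CoinvGL2.mu p)} ∪
            {a | ∃ i : ℕ, 2 ≤ i ∧ i ≤ p - 1 ∧
              a = CoinvGL2.proj (CoinvGL2.L p r) (CoinvGL2.gam p i)})) :=
  ⟨fun h => CoinvGL2.positiveInvariants_L_eq_bot hr h, by
    rintro rfl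
    exact ⟨CoinvGL2.isFundamentalClass_mu, CoinvGL2.positiveInvariants_L_one⟩⟩
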